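/- Let $c\ge 0$ and $\kappa\in\mathbb R$, and consider the equation $$icu'+u''+u(1-|u|^2)+\kappa u(1-|u|^2)''=0\quad\text{on }\mathbb R,\qquad (\mathrm{TW}(c,\kappa))$$ for $u:\mathbb R\to\mathbb C$. Let $\mathcal X(\mathbb R)=\{v\in H^1_{\rm loc}(\mathbb R;\mathbb C): 1-|v|^2\in L^2(\mathbb R),\ v'\in L^2(\mathbb R)\}$. Put $$\mathcal D_1=\{0\le c<\sqrt2,\ 0<\kappa<\tfrac12\},\quad \mathcal D_2=\{0\le c<\sqrt2,\ \kappa\le 0\},\quad \mathcal D_3=\{c>\sqrt2,\ \kappa>\tfrac12\},$$ $\mathcal D=\mathcal D_1\cup\mathcal D_2\cup\mathcal D_3$. Let $\mathcal I_c=(0,1-c^2/2]$ if $c<\sqrt2$ and $\mathcal J_c=[1-c^2/2,0)$ if $c>\sqrt 2$. With $$r(y)=\frac{2-c^2-2y}{1-2\kappa+2\kappa y},\qquad m(y)=2\sqrt{\tfrac{1-2\kappa}{2-c^2}}\ \mathrm{atanh}\Big(\sqrt{\tfrac{1-2\kappa}{2-c^2}\,r(y)}\Big),$$ define $F_{c,\kappa}(y)=2\sqrt{\kappa}\,\mathrm{atan}\big(\sqrt{\kappa\,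 r(y)}\big)+m(y)$ on $\mathcal I_c$ for $(c,\kappa)\in\mathcal D_1$; $G_{c,\kappa}(y)=-2\sqrt{-\kappa}\,\mathrm{atanh}\big(\sqrt{-\kappa\, r(y)}\big)+m(y)$ on $\mathcal I_c$ for $(c,\kappa)\in\mathcal D_2$; and $H_{c,\kappa}$ by the same formula as $F_{c,\kappa}$, on $\mathcal J_c$, for $(c,\kappa)\in\mathcal D_3$. 1. If $(c,\kappa)\notin\mathcal D$ and $u\in\mathcal X(\mathbb R)\cap\mathcal C^2(\mathbb R)$ solves $(\mathrm{TW}(c,\kappa))$, then there is $\phi\in\mathbb R$ with $u(x)=e^{i\phi}$ for all $x\in\mathbb R$. 2. Let $(c,\kappa)\in\mathcal D$. Then $F_{c,\kappa}$, $G_{c,\kappa}$, $H_{c,\kappa}$, respectively, is a bijection from its interval onto $[0,\infty)$. Let $\eta_{c,\kappa}:\mathbb R\to\mathbb R$ be the even function that equals $F_{c,\kappa}^{-1}$ if $(c,\kappa)\in\mathcal D_1$, $G_{c,\kappa}^{-1}$ if $(c,\kappa)\in\mathcal D_2$, and $H_{c,\kappa}^{-1}$ if $(c,\kappa)\in\mathcal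 D_3$, on $[0,\infty)$. - If $c>0$, then $\eta_{c,\kappa}<1$ on $\mathbb R$, and $$u_{c,\kappa}(x)=\sqrt{1-\eta_{c,\kappa}(x)}\,e^{i\theta_{c,\kappa}(x)},\qquad \theta_{c,\kappa}(x)=\frac c2\int_0^x\frac{\eta_{c,\kappa}(y)}{1-\eta_{c,\kappa}(y)}\,dy,$$ is, up to translation and multiplication by a constant phase, the unique solution of $(\mathrm{TW}(c,\kappa))$ in $\mathcal C^2(\mathbb R)\cap\mathcal X(\mathbb R)$ that is not a constant of modulus one. - If $c=0$, the same holds for the real-valued odd function $u_{0,\kappa}(x)=\pm\sqrt{1-\eta_{0,\kappa}(x)}$ for $\pm x\ge 0$. In addition, for every $(c,\kappa)\in\mathcal D$, $u_{c,\kappa}$ and $\eta_{c,\kappa}$ belong to $\mathcal C^\infty(\mathbb R)$, and $\eta_{c,\kappa}$ is even and has a global extremum at the origin, with $\eta_{c,\kappa}(0)=1-c^2/2$. Moreover $\eta_{c,\kappa}>0$ and $\eta_{c,\kappa}'<0$ on $(0,\infty)$ if $(c,\kappa)\in\mathcal D_1\cup\mathcal D_2$, while $\eta_{c,\kappa}<0$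 and $\eta_{c,\kappa}'>0$ on $(0,\infty)$ if $(c,\kappa)\in\mathcal D_3$. Finally, there is a constant $C>0$ such that for every integer $k\ge 0$ there is a constant $A>0$ with $$|D^k u_{c,\kappa}'(x)|+|D^k\eta_{c,\kappa}(x)|\le A e^{-C|x|}\qquad\text{for all }x\in\mathbb R.$$ -/

import Mathlib

namespace QGP

noncomputable section

/-! ### Finite energy travelling waves -/

/-- `w` is a weak (distributional) derivative of `v` on the real line. -/
def IsWeakDeriv (v w : ℝ → ℂ) : Prop :=
  ∀ φ : ℝ → ℝ, ContDiff ℝ (⊤ : ℕ∞) φ → HasCompactSupport φ →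
    ∫ x, deriv φ x • v x = -∫ x, φ x • w x

/-- The energy space `{v ∈ H¹_loc(ℝ) : 1 - |v|² ∈ L²(ℝ), v' ∈ L²(ℝ)}`. Membership in `H¹_loc`
means that `v` is in `L²` on compact sets and has a weak derivative in `L²` on compact sets;
the last requirement is contained in `v' ∈ L²(ℝ)`. -/
def energySpace : Set (ℝ → ℂ) :=
  {v | (∀ K : Set ℝ, IsCompact K → MeasureTheory.MemLp v 2 (MeasureTheory.volume.restrict K)) ∧
    MeasureTheory.MemLp (fun x => 1 - ‖v x‖ ^ 2) 2 MeasureTheory.volume ∧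
    ∃ w : ℝ → ℂ, IsWeakDeriv v w ∧ MeasureTheory.MemLp w 2 MeasureTheory.volume}

/-- The travelling wave equation
`i c u' + u'' + u (1 - |u|²) + κ u (1 - |u|²)'' = 0` on `ℝ`. -/
def TWEquation (c κ : ℝ) (u : ℝ → ℂ) : Prop :=
  ∀ x : ℝ, Complex.I * (c : ℂ) * deriv u x + deriv (deriv u) x
    + u x * ((1 - ‖u x‖ ^ 2 : ℝ) : ℂ)
    + (κ : ℂ) * u x * ((deriv (deriv (fun y : ℝ => 1 - ‖u y‖ ^ 2)) x : ℝ) : ℂ) = 0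

/-- `u` is a solution of the travelling wave equation in `𝒞²(ℝ) ∩ 𝒳(ℝ)`. -/
def IsSmoothSol (c κ : ℝ) (u : ℝ → ℂ) : Prop :=
  ContDiff ℝ 2 u ∧ u ∈ energySpace ∧ TWEquation c κ u

/-- `u` is a constant of modulus one. -/
def IsTrivial (u : ℝ → ℂ) : Prop :=
  ∃ φ : ℝ, ∀ x : ℝ, u x = Complex.exp ((φ : ℂ) * Complex.I)

/-- `u` is, up to translation and phase shift, the unique nontrivial solution of the travelling
wave equation in `𝒞²(ℝ) ∩ 𝒳(ℝ)`. -/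
def IsUniqueNontrivialSol (c κ : ℝ) (u : ℝ → ℂ) : Prop :=
  IsSmoothSol c κ u ∧ ¬ IsTrivial u ∧
    ∀ v : ℝ → ℂ, IsSmoothSol c κ v → ¬ IsTrivial v →
      ∃ x₀ φ : ℝ, ∀ x : ℝ, v x = Complex.exp ((φ : ℂ) * Complex.I) * u (x - x₀)

/-! ### Regions of parameters -/

def D₁ : Set (ℝ × ℝ) := {p | 0 ≤ p.1 ∧ p.1 < √2 ∧ 0 < p.2 ∧ p.2 < 1 / 2}

def D₂ : Set (ℝ × ℝ) := {p | 0 ≤ p.1 ∧ p.1 < √2 ∧ p.2 ≤ 0}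

def D₃ : Set (ℝ × ℝ) := {p | √2 < p.1 ∧ 1 / 2 < p.2}

def D : Set (ℝ × ℝ) := D₁ ∪ D₂ ∪ D₃

/-! ### Explicit solitons -/

/-- The interval `(0, 1 - c²/2]`. -/
def intervalI (c : ℝ) : Set ℝ := Set.Ioc 0 (1 - c ^ 2 / 2)

/-- The interval `[1 - c²/2, 0)`. -/
def intervalJ (c : ℝ) : Set ℝ := Set.Ico (1 - c ^ 2 / 2) 0

/-- The function `F_{c,κ}`. -/
def funF (c κ y : ℝ) : ℝ :=
  2 * √κ * Real.arctan (√κ * √((2 - c ^ 2 - 2 * y) / (1 - 2 * κ + 2 * κ * y)))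
    + 2 * √((1 - 2 * κ) / (2 - c ^ 2)) *
      Real.artanh (√(((1 - 2 * κ) * (2 - c ^ 2 - 2 * y)) /
        ((2 - c ^ 2) * (1 - 2 * κ + 2 * κ * y))))

/-- The function `G_{c,κ}`. -/
def funG (c κ y : ℝ) : ℝ :=
  -2 * √(-κ) * Real.artanh (√(-κ) * √((2 - c ^ 2 - 2 * y) / (1 - 2 * κ + 2 * κ * y)))
    + 2 * √((1 - 2 * κ) / (2 - c ^ 2)) *
      Real.artanh (√(((1 - 2 * κ) * (2 - c ^ 2 - 2 * y)) /
        ((2 - c ^ 2) * (1 - 2 * κ + 2 * κ * y))))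

/-- The function `H_{c,κ}`, given by the same formula as `F_{c,κ}` (but considered on the interval
`[1 - c²/2, 0)`). -/
def funH (c κ y : ℝ) : ℝ := funF c κ y

/-- The even extension to `ℝ` of the inverse of the restriction of `g` to `s`. -/
def evenInverse (g : ℝ → ℝ) (s : Set ℝ) (x : ℝ) : ℝ := Function.invFunOn g s |x|

open scoped Classical in
/-- The intensity profile `η_{c,κ}`; it is only meaningful for `(c, κ) ∈ D`. -/
def eta (c κ : ℝ) : ℝ → ℝ :=
  if (c, κ) ∈ D₁ then evenInverse (funF c κ) (intervalI c)
  else if (c, κ) ∈ D₂ then evenInverse (funG c κ) (intervalI c)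
  else evenInverse (funH c κ) (intervalJ c)

/-- The phase `θ_{c,κ}`. -/
def theta (c κ x : ℝ) : ℝ := c / 2 * ∫ y in (0 : ℝ)..x, eta c κ y / (1 - eta c κ y)

/-- The soliton `√(1 - η) e^{iθ}` for `c > 0`. -/
def solitonPos (c κ x : ℝ) : ℂ :=
  ((√(1 - eta c κ x) : ℝ) : ℂ) * Complex.exp ((theta c κ x : ℂ) * Complex.I)

/-- The black soliton `±√(1 - η_{0,κ}(x))` for `±x ≥ 0`. -/
def blackSoliton (κ x : ℝ) : ℂ :=
  if 0 ≤ x then ((√(1 - eta 0 κ x) : ℝ) : ℂ) else ((-√(1 - eta 0 κ x) : ℝ) : ℂ)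

/-- The soliton `u_{c,κ}`. -/
def soliton (c κ : ℝ) : ℝ → ℂ :=
  if c = 0 then blackSoliton κ else solitonPos c κ

end

end QGP

namespace QGP

noncomputable section

open Real Set Filter Topology MeasureTheory

/-! ### Inverse hyperbolic tangent -/

/-! Write η = 1 - |u|². Along a C² solution, Im(ū u') - cη/2 and |u'|² - η²/2 - κη'²/2 are constant,
and finite energy forces both constants to vanish (`momentum`, `energy`). Since η' = -2 Re(ū u') and
Re(ū u')² + Im(ū u')² = |u|²|u'|², this yields the scalar law η'²(1 - 2κ + 2κη) = η²(2 - c² - 2η)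
(`deriv_intensity_sq`), together with a second-order law for η'' (`deriv_deriv_intensity_eq`).

Finite energy also gives η → 0 at infinity. If η is not identically zero it therefore attains a
nonzero extremum, necessarily of value 1 - c²/2, and it also takes all small values of that sign. At
such small values the scalar law makes 2 - c² and 1 - 2κ agree in sign, which leaves exactly `D`,
apart from the degenerate case κ = 1/2, which is excluded by a connectedness argument
(`intensity_eq_zero_of_kappa_eq_half`). If η = 0 everywhere, the energy law gives u' = 0.

Inside `D` the scalar law separates, and F, G, H are its time integrals. With s the sign of 1 - c²/2
and y = sη, all three regions reduce to one problem, (p + 2κy) y'² = 2y²(m - y) with m = |1 - c²/2|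
and p = |1 - 2κ| (`EtaData`, `Admissible`). Inverting the time integral gives the profile. Although
the first-order equation is singular at the maximum y = m, the profile solves y'' = `accel` y with a
smooth right side; smoothness, uniqueness and decay of all derivatives come from that equation.

For uniqueness, the intensity of any nontrivial solution is a translate of η (`exists_translate`).
Once the intensity is known, the travelling wave equation is linear in u with bounded coefficients,
and the conservation laws determine (u, u') at the extremum up to a phase (`exists_phase`).
Existence is a direct verification from the two laws for η, with the polar form for c > 0 and a real
odd function for c = 0. -/

theorem hasDerivAt_artanh {t : ℝ} (h₁ : -1 < t) (h₂ : t < 1) :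
    HasDerivAt artanh (1 / (1 - t ^ 2)) t := by
  have h : HasDerivAt (fun x : ℝ => 1 / 2 * (log (1 + x) - log (1 - x)))
      (1 / 2 * (1 / (1 + t) - (-1) / (1 - t))) t :=
    ((((hasDerivAt_id t).const_add 1).log (by simp; linarith)).sub
      (((hasDerivAt_id t).const_sub 1).log (by simp; linarith))).const_mul _
  have e : artanh =ᶠ[𝓝 t] fun x : ℝ => 1 / 2 * (log (1 + x) - log (1 - x)) := by
    filter_upwards [Ioo_mem_nhds h₁ h₂] with x hx
    rw [artanh_eq_half_log ⟨hx.1.le, hx.2.le⟩,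
      log_div (by linarith [hx.1]) (by linarith [hx.2])]
  refine (h.congr_of_eventuallyEq e).congr_deriv ?_
  have e₁ : 1 + t ≠ 0 := by linarith
  have e₂ : 1 - t ≠ 0 := by linarith
  have e₃ : 1 - t ^ 2 ≠ 0 := by
    have : 1 - t ^ 2 = (1 + t) * (1 - t) := by ring
    rw [this]; exact mul_ne_zero e₁ e₂
  field_simp
  ring

/-! ### The profile of the intensity, up to sign -/

/-- Parameters for which the profile equation `(p + 2κy) y'² = 2 y² (m - y)` has a solution
which decays to `0` and has maximum `m`. -/
structure Admissible (m p κ : ℝ) : Prop where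
  m_pos : 0 < m
  p_pos : 0 < p
  q_pos : 0 < p + 2 * κ * m

/-- The square of the logarithmic derivative of the profile. -/
def rate (m p κ y : ℝ) : ℝ := (2 * m - 2 * y) / (p + 2 * κ * y)

/-- The part of the arrival time coming from the quasilinear term. -/
def timeCorrection (κ t : ℝ) : ℝ :=
  if 0 < κ then 2 * √κ * arctan (√κ * t) else -2 * √(-κ) * artanh (√(-κ) * t)

/-- The time that the profile needs to go from `m` down to `y`. -/
def profileTime (m p κ y : ℝ) : ℝ :=
  timeCorrection κ √(rate m p κ y) + 2 * √(p / (2 * m)) *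
    artanh (√((p * (2 * m - 2 * y)) / (2 * m * (p + 2 * κ * y))))

theorem rate_self (m p κ : ℝ) : rate m p κ m = 0 := by simp [rate]

theorem profileTime_self (m p κ : ℝ) : profileTime m p κ m = 0 := by
  simp [profileTime, rate_self, timeCorrection]

/-- Both branches are antiderivatives of the same rational function, so later arguments need no case
split on the sign of κ. For κ ≤ 0 the positivity hypothesis says that the argument of `artanh` is
below 1. -/
theorem hasDerivAt_timeCorrection {κ t : ℝ} (ht : 0 ≤ t) (h : 0 < 1 + κ * t ^ 2) :
    HasDerivAt (timeCorrection κ) (2 * κ / (1 + κ * t ^ 2)) t := by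
  unfold timeCorrection
  split_ifs with hκ
  · have := (((hasDerivAt_id t).const_mul √κ).arctan).const_mul (2 * √κ)
    refine this.congr_deriv ?_
    simp only [id, mul_pow, sq_sqrt hκ.le]
    have hs : √κ * √κ = κ := mul_self_sqrt hκ.le
    calc 2 * √κ * (1 / (1 + κ * t ^ 2) * (√κ * 1)) = 2 * (√κ * √κ) / (1 + κ * t ^ 2) := by ring
      _ = _ := by rw [hs]
  · have hκ' : 0 ≤ -κ := by linarith
    have h0 : 0 ≤ √(-κ) * t := by positivity
    have hsq : (√(-κ) * t) ^ 2 = -κ * t ^ 2 := by rw [mul_pow, sq_sqrt hκ']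
    have h1 : √(-κ) * t < 1 := by nlinarith
    have := ((hasDerivAt_artanh (by linarith) h1).comp t
      ((hasDerivAt_id t).const_mul √(-κ))).const_mul (-2 * √(-κ))
    refine this.congr_deriv ?_
    rw [hsq]
    have hs : √(-κ) * √(-κ) = -κ := mul_self_sqrt hκ'
    have : -2 * √(-κ) * (1 / (1 - -κ * t ^ 2) * (√(-κ) * 1))
        = -2 * (√(-κ) * √(-κ)) / (1 - -κ * t ^ 2) := by ring
    rw [this, hs]
    ring

/-- A lower bound uniform in t ∈ [0, T]: the correction cannot cancel the divergence of the other
term of `profileTime`. For κ > 0 the left side is zero, since `√(-κ) = 0`. -/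
theorem timeCorrection_ge {κ t T : ℝ} (ht : 0 ≤ t) (htT : t ≤ T) (h : 0 < 1 + κ * T ^ 2) :
    -2 * √(-κ) * artanh (√(-κ) * T) ≤ timeCorrection κ t := by
  unfold timeCorrection
  split_ifs with hκ
  · rw [sqrt_eq_zero_of_nonpos (by linarith : -κ ≤ 0)]
    have : 0 ≤ arctan (√κ * t) := arctan_nonneg.2 (by positivity)
    have : 0 ≤ 2 * √κ * arctan (√κ * t) := by positivity
    simpa using this
  · have hκ' : 0 ≤ -κ := by linarith
    have hsq : (√(-κ) * T) ^ 2 = -κ * T ^ 2 := by rw [mul_pow, sq_sqrt hκ']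
    have h0 : 0 ≤ √(-κ) * t := by positivity
    have hle : √(-κ) * t ≤ √(-κ) * T := by gcongr
    have h1 : √(-κ) * T < 1 := by nlinarith
    have := artanh_le_artanh (by linarith) h1 hle
    have := mul_le_mul_of_nonneg_left this (by positivity : 0 ≤ 2 * √(-κ))
    linarith

/-! ### The arrival time as a decreasing bijection. -/

namespace Admissible

variable {m p κ : ℝ} (h : Admissible m p κ)
include h

/-- The expression is affine in y and positive at both endpoints 0 and m. -/
theorem den_pos {y : ℝ} (hy : y ∈ Icc 0 m) : 0 < p + 2 * κ * y := by
  have e : m * (p + 2 * κ * y) = (m - y) * p + y * (p + 2 * κ * m) := by ring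
  have hm := h.m_pos
  have h1 : 0 < (m - y) * p + y * (p + 2 * κ * m) := by
    rcases hy.1.eq_or_lt with h0 | h0
    · subst h0; have := mul_pos hm h.p_pos; linarith
    · have := mul_pos h0 h.q_pos
      have := mul_nonneg (sub_nonneg.2 hy.2) h.p_pos.le
      linarith
  rw [← e] at h1
  exact pos_of_mul_pos_right h1 hm.le

theorem rate_nonneg {y : ℝ} (hy : y ∈ Icc 0 m) : 0 ≤ rate m p κ y :=
  div_nonneg (by linarith [hy.2]) (h.den_pos hy).le

theorem rate_pos {y : ℝ} (hy : y ∈ Ico 0 m) : 0 < rate m p κ y :=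
  div_pos (by linarith [hy.2]) (h.den_pos ⟨hy.1, hy.2.le⟩)

theorem rate_antitone : AntitoneOn (rate m p κ) (Icc 0 m) := by
  intro x hx y hy hxy
  unfold rate
  rw [div_le_div_iff₀ (h.den_pos hy) (h.den_pos hx)]
  nlinarith [mul_nonneg (sub_nonneg.2 hxy) h.q_pos.le]

theorem hasDerivAt_rate {y : ℝ} (hy : y ∈ Icc 0 m) :
    HasDerivAt (rate m p κ) (-2 * (p + 2 * κ * m) / (p + 2 * κ * y) ^ 2) y := by
  have hP := h.den_pos hy
  have h1 : HasDerivAt (fun y : ℝ => 2 * m - 2 * y) (-2) y := by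
    simpa using ((hasDerivAt_id y).const_mul 2).const_sub (2 * m)
  have h2 : HasDerivAt (fun y : ℝ => p + 2 * κ * y) (2 * κ) y := by
    simpa using ((hasDerivAt_id y).const_mul (2 * κ)).const_add p
  refine (h1.div h2 hP.ne').congr_deriv ?_
  congr 1
  ring

theorem one_add_mul_rate {y : ℝ} (hy : y ∈ Icc 0 m) :
    1 + κ * rate m p κ y = (p + 2 * κ * m) / (p + 2 * κ * y) := by
  have hP := (h.den_pos hy).ne'
  rw [eq_div_iff hP, rate, add_mul, mul_assoc κ, div_mul_cancel₀ _ hP]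
  ring

/-- The right side is positive for y > 0 and vanishes at y = 0: the `artanh` in `profileTime` is
finite on (0, m] and diverges as y → 0. -/
theorem one_sub_mul_rate {y : ℝ} (hy : y ∈ Icc 0 m) :
    1 - p / (2 * m) * rate m p κ y
      = y * (p + 2 * κ * m) / (m * (p + 2 * κ * y)) := by
  have hP := (h.den_pos hy).ne'
  have hm := h.m_pos.ne'
  rw [eq_div_iff (mul_ne_zero hm hP), rate]
  generalize hd : p + 2 * κ * y = d at hP ⊢
  field_simp
  rw [← hd]
  ring

theorem profileTime_eq {y : ℝ} :
    profileTime m p κ y = timeCorrection κ √(rate m p κ y) + 2 * √(p / (2 * m)) *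
      artanh (√(p / (2 * m)) * √(rate m p κ y)) := by
  unfold profileTime
  congr 3
  have hm := h.m_pos
  have hp := h.p_pos
  rw [← sqrt_mul (by positivity), rate, div_mul_div_comm]

theorem mul_sqrt_rate_lt_one {y : ℝ} (hy : y ∈ Ioc 0 m) :
    √(p / (2 * m)) * √(rate m p κ y) < 1 := by
  have hm := h.m_pos
  have hp := h.p_pos
  have hy' : y ∈ Icc 0 m := ⟨hy.1.le, hy.2⟩
  have h1 := h.one_sub_mul_rate hy'
  have h2 : 0 < y * (p + 2 * κ * m) / (m * (p + 2 * κ * y)) :=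
    div_pos (mul_pos hy.1 h.q_pos) (mul_pos hm (h.den_pos hy'))
  rw [← sqrt_mul (by positivity), sqrt_lt' one_pos]
  linarith

/-- The arrival time as a function of the square root of the rate. -/
theorem hasDerivAt_time_sqrt {y : ℝ} (hy : y ∈ Ioc 0 m) :
    HasDerivAt (fun t => timeCorrection κ t + 2 * √(p / (2 * m)) * artanh (√(p / (2 * m)) * t))
      ((p + 2 * κ * y) ^ 2 / (y * (p + 2 * κ * m))) √(rate m p κ y) := by
  have hm := h.m_pos
  have hp := h.p_pos
  have hy' : y ∈ Icc 0 m := ⟨hy.1.le, hy.2⟩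
  have hR := h.rate_nonneg hy'
  have hP := h.den_pos hy'
  have hq := h.q_pos
  have h1 : 0 < 1 + κ * √(rate m p κ y) ^ 2 := by
    rw [sq_sqrt hR, h.one_add_mul_rate hy']
    positivity
  have h2 := h.mul_sqrt_rate_lt_one hy
  have h0 : 0 ≤ √(p / (2 * m)) * √(rate m p κ y) := by positivity
  have ha : √(p / (2 * m)) ^ 2 = p / (2 * m) := sq_sqrt (by positivity)
  have := (hasDerivAt_timeCorrection (sqrt_nonneg _) h1).add
    (((hasDerivAt_artanh (by linarith) h2).comp √(rate m p κ y)
      ((hasDerivAt_id _).const_mul √(p / (2 * m)))).const_mul (2 * √(p / (2 * m))))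
  refine this.congr_deriv ?_
  rw [mul_pow, sq_sqrt hR, ha, h.one_add_mul_rate hy', h.one_sub_mul_rate hy']
  have e : ∀ b : ℝ, 2 * √(p / (2 * m)) * (b * (√(p / (2 * m)) * 1))
      = 2 * (p / (2 * m)) * b := fun b => by
    calc _ = 2 * √(p / (2 * m)) ^ 2 * b := by ring
      _ = _ := by rw [ha]
  rw [e]
  have := hy.1.ne'
  field_simp
  ring

/-- Factoring through t = √rate covers the endpoint y = m: the outer function is differentiable at t
= 0, and the square root only has to be continuous there. -/
theorem continuousOn_profileTime : ContinuousOn (profileTime m p κ) (Ioc 0 m) := by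
  intro y hy
  have hy' : y ∈ Icc 0 m := ⟨hy.1.le, hy.2⟩
  have : profileTime m p κ = (fun t => timeCorrection κ t + 2 * √(p / (2 * m)) *
      artanh (√(p / (2 * m)) * t)) ∘ fun y => √(rate m p κ y) := by
    ext y; exact h.profileTime_eq
  rw [this]
  apply ContinuousAt.continuousWithinAt
  exact ContinuousAt.comp (h.hasDerivAt_time_sqrt hy).continuousAt
    (h.hasDerivAt_rate hy').continuousAt.sqrt

/-- This is the separated equation: the inverse of `profileTime` satisfies y' = -y √rate. -/
theorem hasDerivAt_profileTime {y : ℝ} (hy : y ∈ Ioo 0 m) :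
    HasDerivAt (profileTime m p κ) (-1 / (y * √(rate m p κ y))) y := by
  have hy' : y ∈ Icc 0 m := ⟨hy.1.le, hy.2.le⟩
  have hR := h.rate_pos ⟨hy.1.le, hy.2⟩
  have hP := h.den_pos hy'
  have : profileTime m p κ = (fun t => timeCorrection κ t + 2 * √(p / (2 * m)) *
      artanh (√(p / (2 * m)) * t)) ∘ fun y => √(rate m p κ y) := by
    ext y; exact h.profileTime_eq
  rw [this]
  refine ((h.hasDerivAt_time_sqrt ⟨hy.1, hy.2.le⟩).comp y
    ((h.hasDerivAt_rate hy').sqrt hR.ne')).congr_deriv ?_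
  have := hy.1.ne'
  have := h.q_pos.ne'
  have := (sqrt_pos.2 hR).ne'
  field_simp

theorem strictAntiOn_profileTime : StrictAntiOn (profileTime m p κ) (Ioc 0 m) := by
  refine strictAntiOn_of_deriv_neg (convex_Ioc _ _) h.continuousOn_profileTime fun y hy => ?_
  rw [interior_Ioc] at hy
  rw [(h.hasDerivAt_profileTime hy).deriv]
  have := sqrt_pos.2 (h.rate_pos ⟨hy.1.le, hy.2⟩)
  exact div_neg_of_neg_of_pos (by norm_num) (mul_pos hy.1 this)

/-- The correction is at least B, while `artanh` takes every real value on (-1, 1). -/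
theorem exists_le_profileTime (T : ℝ) : ∃ y ∈ Ioc 0 m, T ≤ profileTime m p κ y := by
  have hm := h.m_pos
  have hp := h.p_pos
  set a := √(p / (2 * m)) with ha
  have ha0 : 0 < a := sqrt_pos.2 (by positivity)
  have ha2 : a ^ 2 = p / (2 * m) := sq_sqrt (by positivity)
  set B := -2 * √(-κ) * artanh (√(-κ) * √(rate m p κ 0))
  -- The maximum with 0 makes z nonnegative, so that z can be the value of a square root.
  obtain ⟨z, hz, hzT⟩ := artanh_surjOn (mem_univ (max ((T - B) / (2 * a)) 0))
  have hz0 : 0 ≤ z := by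
    by_contra! hneg
    have := artanh_neg ⟨hz.1, hneg⟩
    have := le_max_right ((T - B) / (2 * a)) 0
    linarith
  have hz1 : z ^ 2 < 1 := by nlinarith [hz.2]
  have hden : 0 < p + 2 * κ * m * z ^ 2 := by
    have : p + 2 * κ * m * z ^ 2 = (1 - z ^ 2) * p + z ^ 2 * (p + 2 * κ * m) := by ring
    rw [this]
    have := mul_pos (sub_pos.2 hz1) hp
    have := mul_nonneg (sq_nonneg z) h.q_pos.le
    linarith
  -- The solution of (p / 2m) · rate y = z².
  set y := p * m * (1 - z ^ 2) / (p + 2 * κ * m * z ^ 2) with hy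
  have hy0 : 0 < y := div_pos (mul_pos (mul_pos hp hm) (by linarith)) hden
  have hym : y ≤ m := by
    rw [hy, div_le_iff₀ hden]
    have := mul_nonneg (mul_nonneg (sq_nonneg z) h.q_pos.le) hm.le
    linarith
  refine ⟨y, ⟨hy0, hym⟩, ?_⟩
  have hyI : y ∈ Icc 0 m := ⟨hy0.le, hym⟩
  have hP := h.den_pos hyI
  have hR : a * √(rate m p κ y) = z := by
    have : p / (2 * m) * rate m p κ y = z ^ 2 := by
      have e : y * (p + 2 * κ * m * z ^ 2) = p * m * (1 - z ^ 2) := by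
        rw [hy]; exact div_mul_cancel₀ _ hden.ne'
      unfold rate
      rw [div_mul_div_comm, div_eq_iff (by positivity)]
      linarith
    rw [ha, ← sqrt_mul (by positivity), this, sqrt_sq hz0]
  rw [h.profileTime_eq, ← ha, hR, hzT]
  have h1 : B ≤ timeCorrection κ √(rate m p κ y) := by
    refine timeCorrection_ge (sqrt_nonneg _)
      (sqrt_le_sqrt (h.rate_antitone ⟨le_rfl, hm.le⟩ hyI hy0.le)) ?_
    rw [sq_sqrt (h.rate_nonneg ⟨le_rfl, hm.le⟩), h.one_add_mul_rate ⟨le_rfl, hm.le⟩]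
    simpa using div_pos h.q_pos hp
  have h2 : T - B ≤ 2 * a * max ((T - B) / (2 * a)) 0 := by
    have := mul_le_mul_of_nonneg_left (le_max_left ((T - B) / (2 * a)) 0)
      (by positivity : 0 ≤ 2 * a)
    rwa [mul_div_cancel₀ _ (by positivity)] at this
  linarith

theorem bijOn_profileTime : BijOn (profileTime m p κ) (Ioc 0 m) (Ici 0) := by
  have hmem : m ∈ Ioc 0 m := ⟨h.m_pos, le_rfl⟩
  refine ⟨fun y hy => ?_, h.strictAntiOn_profileTime.injOn, fun T hT => ?_⟩
  · have := h.strictAntiOn_profileTime.antitoneOn hy hmem hy.2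
    rwa [profileTime_self] at this
  · obtain ⟨y, hy, hTy⟩ := h.exists_le_profileTime T
    have hsub : Icc y m ⊆ Ioc 0 m := fun z hz => ⟨hy.1.trans_le hz.1, hz.2⟩
    have := intermediate_value_Icc' hy.2 (h.continuousOn_profileTime.mono hsub)
    rw [profileTime_self] at this
    obtain ⟨z, hz, hzT⟩ := this ⟨hT, hTy⟩
    exact ⟨z, hsub hz, hzT⟩

end Admissible

/-- The even profile with maximum `m` at the origin. -/
def profile (m p κ : ℝ) : ℝ → ℝ := evenInverse (profileTime m p κ) (Ioc 0 m)

/-- The derivative of the profile. -/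
def profileDeriv (m p κ x : ℝ) : ℝ :=
  if 0 ≤ x then -(profile m p κ x * √(rate m p κ (profile m p κ x)))
  else profile m p κ x * √(rate m p κ (profile m p κ x))

/-- The profile solves the autonomous equation `y'' = accel y`. -/
def accel (m p κ y : ℝ) : ℝ :=
  y * ((2 * m - 3 * y) * (p + 2 * κ * y) - 2 * κ * y * (m - y)) / (p + 2 * κ * y) ^ 2

theorem profile_neg (m p κ x : ℝ) : profile m p κ (-x) = profile m p κ x := by
  simp [profile, evenInverse]

/-! ### Differential equation, smoothness and exponential decay of the profile. -/

namespace Admissible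

variable {m p κ : ℝ} (h : Admissible m p κ)
include h

theorem profile_mem (x : ℝ) : profile m p κ x ∈ Ioc 0 m :=
  Function.invFunOn_mem (h.bijOn_profileTime.surjOn (abs_nonneg x))

theorem profile_mem_Icc (x : ℝ) : profile m p κ x ∈ Icc 0 m :=
  ⟨(h.profile_mem x).1.le, (h.profile_mem x).2⟩

theorem profileTime_profile (x : ℝ) : profileTime m p κ (profile m p κ x) = |x| :=
  Function.invFunOn_eq (h.bijOn_profileTime.surjOn (abs_nonneg x))

theorem lt_profile_iff {x y : ℝ} (hy : y ∈ Ioc 0 m) :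
    y < profile m p κ x ↔ |x| < profileTime m p κ y := by
  rw [← h.profileTime_profile x, h.strictAntiOn_profileTime.lt_iff_gt (h.profile_mem x) hy]

theorem profile_lt_iff {x y : ℝ} (hy : y ∈ Ioc 0 m) :
    profile m p κ x < y ↔ profileTime m p κ y < |x| := by
  rw [← h.profileTime_profile x, h.strictAntiOn_profileTime.lt_iff_gt hy (h.profile_mem x)]

theorem profile_eq_iff {x y : ℝ} (hy : y ∈ Ioc 0 m) :
    profile m p κ x = y ↔ |x| = profileTime m p κ y := by
  rw [← h.profileTime_profile x]
  exact (h.bijOn_profileTime.injOn.eq_iff (h.profile_mem x) hy).symm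

theorem profile_zero : profile m p κ 0 = m := by
  rw [h.profile_eq_iff ⟨h.m_pos, le_rfl⟩, profileTime_self, abs_zero]

theorem profile_lt {x : ℝ} (hx : x ≠ 0) : profile m p κ x < m := by
  rw [h.profile_lt_iff ⟨h.m_pos, le_rfl⟩, profileTime_self]
  exact abs_pos.2 hx

/-- By monotonicity of `profileTime`, the conditions y < profile x and profile x < y are open
conditions on |x|. -/
theorem continuous_profile : Continuous (profile m p κ) := by
  refine continuous_iff_continuousAt.2 fun x => tendsto_order.2 ⟨fun a ha => ?_, fun b hb => ?_⟩
  · have hx := h.profile_mem x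
    -- Replacing a by this maximum keeps the threshold in (0, m], where the order equivalence
    -- applies.
    have ha' : max a (profile m p κ x / 2) < profile m p κ x := max_lt ha (by linarith [hx.1])
    have hm : max a (profile m p κ x / 2) ∈ Ioc 0 m :=
      ⟨lt_max_of_lt_right (by linarith [hx.1]), ha'.le.trans hx.2⟩
    have := (h.lt_profile_iff hm).1 ha'
    filter_upwards [continuous_abs.continuousAt.eventually_lt_const this] with z hz
    exact (le_max_left _ _).trans_lt ((h.lt_profile_iff hm).2 hz)
  · by_cases hbm : b ≤ m
    · have hm : b ∈ Ioc 0 m := ⟨(h.profile_mem x).1.trans hb, hbm⟩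
      have := (h.profile_lt_iff hm).1 hb
      filter_upwards [continuous_abs.continuousAt.eventually_const_lt this] with z hz
      exact (h.profile_lt_iff hm).2 hz
    · exact Eventually.of_forall fun z => (h.profile_mem z).2.trans_lt (not_le.1 hbm)

theorem den_profile_pos (x : ℝ) : 0 < p + 2 * κ * profile m p κ x :=
  h.den_pos (h.profile_mem_Icc x)

theorem continuous_rate_profile : Continuous fun x => rate m p κ (profile m p κ x) :=
  continuous_iff_continuousAt.2 fun x =>
    (h.hasDerivAt_rate (h.profile_mem_Icc x)).continuousAt.comp (f := profile m p κ)
      h.continuous_profile.continuousAt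

theorem abs_profileDeriv (x : ℝ) : |profileDeriv m p κ x|
    = profile m p κ x * √(rate m p κ (profile m p κ x)) := by
  have : 0 ≤ profile m p κ x * √(rate m p κ (profile m p κ x)) :=
    mul_nonneg (h.profile_mem x).1.le (sqrt_nonneg _)
  unfold profileDeriv
  split_ifs
  · rw [abs_neg, abs_of_nonneg this]
  · rw [abs_of_nonneg this]

theorem profileDeriv_zero : profileDeriv m p κ 0 = 0 := by
  simp [profileDeriv, h.profile_zero, rate_self]

theorem continuousAt_profileDeriv_zero : ContinuousAt (profileDeriv m p κ) 0 := by
  unfold ContinuousAt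
  rw [h.profileDeriv_zero, tendsto_zero_iff_abs_tendsto_zero]
  have : Continuous fun x => profile m p κ x * √(rate m p κ (profile m p κ x)) :=
    h.continuous_profile.mul h.continuous_rate_profile.sqrt
  have := this.tendsto 0
  rw [h.profile_zero, rate_self, sqrt_zero, mul_zero] at this
  refine this.congr fun x => ?_
  simp [h.abs_profileDeriv]

theorem hasDerivAt_profile_of_pos {x : ℝ} (hx : 0 < x) :
    HasDerivAt (profile m p κ) (-(profile m p κ x * √(rate m p κ (profile m p κ x)))) x := by
  have hmem : profile m p κ x ∈ Ioo 0 m := ⟨(h.profile_mem x).1, h.profile_lt hx.ne'⟩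
  have hR := sqrt_pos.2 (h.rate_pos ⟨hmem.1.le, hmem.2⟩)
  have := HasDerivAt.of_local_left_inverse h.continuous_profile.continuousAt
    (h.hasDerivAt_profileTime hmem)
    (div_ne_zero (by norm_num) (mul_pos hmem.1 hR).ne')
    (by filter_upwards [eventually_gt_nhds hx] with y hy
        rw [h.profileTime_profile, abs_of_pos hy])
  refine this.congr_deriv ?_
  rw [inv_div, div_neg, div_one]

/-- The inverse function rule fails at x = 0, where `profileTime` has infinite slope. The derivative
off 0 has a limit at 0, though, and a continuous function with this property is differentiable
there. -/
theorem hasDerivAt_profile (x : ℝ) : HasDerivAt (profile m p κ) (profileDeriv m p κ x) x := by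
  have key : ∀ y ≠ (0 : ℝ), HasDerivAt (profile m p κ) (profileDeriv m p κ y) y := by
    intro y hy
    rcases hy.lt_or_gt with hy | hy
    · have := (h.hasDerivAt_profile_of_pos (neg_pos.2 hy)).comp y (hasDerivAt_neg y)
      rw [profileDeriv, if_neg (not_le.2 hy)]
      have e : profile m p κ ∘ Neg.neg = profile m p κ := funext fun z => profile_neg m p κ z
      rw [e, profile_neg] at this
      simpa using this
    · rw [profileDeriv, if_pos hy.le]
      exact h.hasDerivAt_profile_of_pos hy
  by_cases hx : x = 0
  · subst hx
    exact hasDerivAt_of_hasDerivAt_of_ne key h.continuous_profile.continuousAt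
      h.continuousAt_profileDeriv_zero
  · exact key x hx

theorem deriv_profile : deriv (profile m p κ) = profileDeriv m p κ :=
  funext fun x => (h.hasDerivAt_profile x).deriv

theorem continuous_accel_profile : Continuous fun x => accel m p κ (profile m p κ x) := by
  have hc := h.continuous_profile
  unfold accel
  exact Continuous.div (by fun_prop) (by fun_prop) fun x => (pow_pos (h.den_profile_pos x) 2).ne'

theorem hasDerivAt_mul_sqrt_rate {x : ℝ} (hx : x ≠ 0) :
    HasDerivAt (fun x => profile m p κ x * √(rate m p κ (profile m p κ x)))
      (profileDeriv m p κ x * (√(rate m p κ (profile m p κ x)) + profile m p κ x *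
        (-2 * (p + 2 * κ * m) / (p + 2 * κ * profile m p κ x) ^ 2
          / (2 * √(rate m p κ (profile m p κ x)))))) x := by
  have hg := h.hasDerivAt_profile x
  have hR := h.rate_pos ⟨(h.profile_mem x).1.le, h.profile_lt hx⟩
  refine (hg.mul (((h.hasDerivAt_rate (h.profile_mem_Icc x)).comp x hg).sqrt
    hR.ne')).congr_deriv ?_
  simp only [Function.comp_apply]
  ring

/-- The square roots in (y√rate) · d(y√rate)/dy cancel, leaving a rational function of y that is
regular at y = m. The sign of y' has dropped out, so the formula is the same on both half-lines. -/
theorem accel_eq {x : ℝ} (hx : x ≠ 0) :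
    accel m p κ (profile m p κ x) = profile m p κ x * √(rate m p κ (profile m p κ x)) *
      (√(rate m p κ (profile m p κ x)) + profile m p κ x *
        (-2 * (p + 2 * κ * m) / (p + 2 * κ * profile m p κ x) ^ 2
          / (2 * √(rate m p κ (profile m p κ x))))) := by
  have hR := h.rate_pos ⟨(h.profile_mem x).1.le, h.profile_lt hx⟩
  have hs := (sqrt_pos.2 hR).ne'
  have hs2 := mul_self_sqrt hR.le
  have hP := (h.den_profile_pos x).ne'
  set s := √(rate m p κ (profile m p κ x))
  generalize profile m p κ x = y at *
  have e : y * s * (s + y * (-2 * (p + 2 * κ * m) / (p + 2 * κ * y) ^ 2 / (2 * s)))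
      = y * (s * s) - y ^ 2 * (p + 2 * κ * m) / (p + 2 * κ * y) ^ 2 := by
    field_simp
    ring
  rw [e, hs2, rate, accel]
  have e2 : y * ((2 * m - 2 * y) / (p + 2 * κ * y))
      = y * (2 * m - 2 * y) * (p + 2 * κ * y) / (p + 2 * κ * y) ^ 2 := by
    rw [pow_two, mul_div_mul_right _ _ hP, mul_div_assoc]
  rw [e2, ← sub_div]
  congr 1
  ring

theorem hasDerivAt_profileDeriv (x : ℝ) :
    HasDerivAt (profileDeriv m p κ) (accel m p κ (profile m p κ x)) x := by
  have key : ∀ y ≠ (0 : ℝ),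
      HasDerivAt (profileDeriv m p κ) (accel m p κ (profile m p κ y)) y := by
    intro y hy
    have hd := h.hasDerivAt_mul_sqrt_rate hy
    rw [h.accel_eq hy]
    rcases hy.lt_or_gt with hy' | hy'
    · have e : profileDeriv m p κ =ᶠ[𝓝 y]
          fun x => profile m p κ x * √(rate m p κ (profile m p κ x)) := by
        filter_upwards [eventually_lt_nhds hy'] with z hz
        rw [profileDeriv, if_neg (not_le.2 hz)]
      refine (hd.congr_of_eventuallyEq e).congr_deriv ?_
      rw [profileDeriv, if_neg (not_le.2 hy')]
    · have e : profileDeriv m p κ =ᶠ[𝓝 y]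
          fun x => -(profile m p κ x * √(rate m p κ (profile m p κ x))) := by
        filter_upwards [eventually_gt_nhds hy'] with z hz
        rw [profileDeriv, if_pos hz.le]
      refine (hd.neg.congr_of_eventuallyEq e).congr_deriv ?_
      rw [profileDeriv, if_pos hy'.le]
      ring
  by_cases hx : x = 0
  · subst hx
    exact hasDerivAt_of_hasDerivAt_of_ne key h.continuousAt_profileDeriv_zero
      h.continuous_accel_profile.continuousAt
  · exact key x hx

theorem deriv_profileDeriv :
    deriv (profileDeriv m p κ) = fun x => accel m p κ (profile m p κ x) :=
  funext fun x => (h.hasDerivAt_profileDeriv x).deriv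

/-- Bootstrap on the pair (y, y'): if y is Cⁿ, then so is y'' = `accel` y, and both members gain one
derivative. -/
theorem contDiff_profile_aux (n : ℕ) :
    ContDiff ℝ n (profile m p κ) ∧ ContDiff ℝ n (profileDeriv m p κ) := by
  induction n with
  | zero =>
    exact ⟨contDiff_zero.2 h.continuous_profile, contDiff_zero.2
      (continuous_iff_continuousAt.2 fun x => (h.hasDerivAt_profileDeriv x).continuousAt)⟩
  | succ n ih =>
    have hacc : ContDiff ℝ n fun x => accel m p κ (profile m p κ x) := by
      have hc := ih.1
      unfold accel
      exact ContDiff.div (by fun_prop) (by fun_prop)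
        fun x => (pow_pos (h.den_profile_pos x) 2).ne'
    push_cast
    constructor
    · refine contDiff_succ_iff_deriv.2
        ⟨fun x => (h.hasDerivAt_profile x).differentiableAt, by simp, ?_⟩
      rw [h.deriv_profile]
      exact ih.2
    · refine contDiff_succ_iff_deriv.2
        ⟨fun x => (h.hasDerivAt_profileDeriv x).differentiableAt, by simp, ?_⟩
      rw [h.deriv_profileDeriv]
      exact hacc

theorem contDiff_profile : ContDiff ℝ (⊤ : ℕ∞) (profile m p κ) :=
  contDiff_infty.2 fun n => (h.contDiff_profile_aux n).1

theorem profileDeriv_sq (x : ℝ) :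
    profileDeriv m p κ x ^ 2 * (p + 2 * κ * profile m p κ x)
      = 2 * profile m p κ x ^ 2 * (m - profile m p κ x) := by
  have hP := (h.den_profile_pos x).ne'
  rw [← sq_abs, h.abs_profileDeriv, mul_pow, sq_sqrt (h.rate_nonneg (h.profile_mem_Icc x)), rate,
    mul_assoc, div_mul_cancel₀ _ hP]
  ring

theorem abs_profileDeriv_le (x : ℝ) :
    |profileDeriv m p κ x| ≤ √(rate m p κ 0) * profile m p κ x := by
  rw [h.abs_profileDeriv, mul_comm]
  have := (h.profile_mem x).1.le
  gcongr
  exact h.rate_antitone ⟨le_rfl, h.m_pos.le⟩ (h.profile_mem_Icc x) this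

/-- The rate grows as y decreases, so y' ≤ -Cy for x ≥ 1, with C the square root of the rate at x =
1; thus y·exp(Cx) is nonincreasing there. Starting from x = 0 would give C = 0, because the rate
vanishes at the maximum. The factor exp C absorbs the interval [0, 1]. -/
theorem exists_profile_le_exp :
    ∃ C > 0, ∃ A, ∀ x, profile m p κ x ≤ A * exp (-C * |x|) := by
  set C := √(rate m p κ (profile m p κ 1)) with hC
  have hC0 : 0 < C := sqrt_pos.2
    (h.rate_pos ⟨(h.profile_mem 1).1.le, h.profile_lt one_ne_zero⟩)
  have hd : ∀ x, HasDerivAt (fun x => profile m p κ x * exp (C * x))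
      (profileDeriv m p κ x * exp (C * x) + profile m p κ x * (exp (C * x) * C)) x := fun x =>
    (h.hasDerivAt_profile x).mul (((hasDerivAt_id x).const_mul C).exp.congr_deriv (by simp))
  have hanti : AntitoneOn (fun x => profile m p κ x * exp (C * x)) (Ici 1) := by
    refine antitoneOn_of_deriv_nonpos (convex_Ici 1)
      (fun x _ => (hd x).continuousAt.continuousWithinAt)
      (fun x _ => (hd x).differentiableAt.differentiableWithinAt) fun x hx => ?_
    rw [interior_Ici] at hx
    have hx1 : (1 : ℝ) < x := hx
    rw [(hd x).deriv, profileDeriv, if_pos (by linarith)]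
    have hg := h.profile_mem x
    have hle : profile m p κ x ≤ profile m p κ 1 := by
      rw [← not_lt, h.lt_profile_iff (h.profile_mem 1), h.profileTime_profile, not_lt, abs_one,
        abs_of_pos (by linarith)]
      exact hx1.le
    have : C ≤ √(rate m p κ (profile m p κ x)) :=
      sqrt_le_sqrt (h.rate_antitone (h.profile_mem_Icc x) (h.profile_mem_Icc 1) hle)
    have e := exp_pos (C * x)
    have := mul_le_mul_of_nonneg_left this (mul_pos hg.1 e).le
    linarith
  have hpos : ∀ x, 0 ≤ x → profile m p κ x ≤ m * exp C * exp (-C * x) := by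
    intro x hx
    rcases le_total x 1 with h1 | h1
    · rw [mul_assoc, ← exp_add]
      have : 1 ≤ exp (C + -C * x) := one_le_exp (by nlinarith)
      have := mul_le_mul_of_nonneg_left this h.m_pos.le
      linarith [(h.profile_mem x).2]
    · have := hanti (mem_Ici.2 le_rfl) h1 h1
      simp only [mul_one] at this
      have h2 : profile m p κ x = profile m p κ x * exp (C * x) * exp (-C * x) := by
        rw [mul_assoc, ← exp_add]; simp
      rw [h2]
      exact mul_le_mul_of_nonneg_right
        (this.trans (mul_le_mul_of_nonneg_right (h.profile_mem 1).2 (exp_pos C).le)) (exp_pos _).le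
  refine ⟨C, hC0, m * exp C, fun x => ?_⟩
  rcases le_total 0 x with hx | hx
  · rw [abs_of_nonneg hx]; exact hpos x hx
  · rw [abs_of_nonpos hx, ← profile_neg]; exact hpos (-x) (by linarith)

end Admissible

/-! ### Calculus of exponentially decaying derivatives. -/

section DerivBound

variable {E : Type*} [NormedAddCommGroup E] [NormedSpace ℝ E]

/-- The first `k` derivatives of `f` are `O(e^{-C|x|})`. -/
def DerivBound (C : ℝ) : ℕ → (ℝ → E) → Prop
  | 0, f => ∃ A, ∀ x, ‖f x‖ ≤ A * exp (-C * |x|)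
  | k + 1, f => (∃ A, ∀ x, ‖f x‖ ≤ A * exp (-C * |x|)) ∧ Differentiable ℝ f ∧
      DerivBound C k (deriv f)

variable {C : ℝ} {k : ℕ}

theorem DerivBound.exists_bound {f : ℝ → E} (h : DerivBound C k f) :
    ∃ A, ∀ x, ‖f x‖ ≤ A * exp (-C * |x|) := by
  cases k with
  | zero => exact h
  | succ k => exact h.1

theorem DerivBound.of_succ {f : ℝ → E} (h : DerivBound C (k + 1) f) : DerivBound C k f := by
  induction k generalizing f with
  | zero => exact h.1
  | succ k ih => exact ⟨h.1, h.2.1, ih h.2.2⟩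

theorem DerivBound.exists_bound_iteratedDeriv {f : ℝ → E} (h : DerivBound C k f) :
    ∃ A, ∀ x, ‖iteratedDeriv k f x‖ ≤ A * exp (-C * |x|) := by
  induction k generalizing f with
  | zero => simpa [DerivBound] using h
  | succ k ih =>
    rw [iteratedDeriv_succ']
    exact ih h.2.2

theorem DerivBound.zero_rate {f : ℝ → E} (hC : 0 ≤ C) (h : DerivBound C k f) :
    DerivBound 0 k f := by
  have key : ∀ g : ℝ → E, (∃ A, ∀ x, ‖g x‖ ≤ A * exp (-C * |x|)) →
      ∃ A, ∀ x, ‖g x‖ ≤ A * exp (-0 * |x|) := by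
    rintro g ⟨A, hA⟩
    have hA0 : 0 ≤ A := by simpa using (norm_nonneg _).trans (hA 0)
    refine ⟨A, fun x => (hA x).trans ?_⟩
    gcongr
  induction k generalizing f with
  | zero => exact key f h
  | succ k ih => exact ⟨key f h.1, h.2.1, ih h.2.2⟩

theorem DerivBound.const (a : E) : DerivBound 0 k fun _ => a := by
  induction k generalizing a with
  | zero => exact ⟨‖a‖, by simp⟩
  | succ k ih =>
    refine ⟨⟨‖a‖, by simp⟩, differentiable_const a, ?_⟩
    rw [deriv_const']
    exact ih 0

theorem DerivBound.add {f g : ℝ → E} (hf : DerivBound C k f) (hg : DerivBound C k g) :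
    DerivBound C k fun x => f x + g x := by
  have key : ∀ f g : ℝ → E, (∃ A, ∀ x, ‖f x‖ ≤ A * exp (-C * |x|)) →
      (∃ A, ∀ x, ‖g x‖ ≤ A * exp (-C * |x|)) →
      ∃ A, ∀ x, ‖f x + g x‖ ≤ A * exp (-C * |x|) := by
    rintro f g ⟨A, hA⟩ ⟨B, hB⟩
    exact ⟨A + B, fun x => (norm_add_le _ _).trans (by linarith [hA x, hB x])⟩
  induction k generalizing f g with
  | zero => exact key f g hf hg
  | succ k ih =>
    refine ⟨key f g hf.1 hg.1, hf.2.1.add hg.2.1, ?_⟩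
    have : deriv (fun x => f x + g x) = fun x => deriv f x + deriv g x :=
      funext fun x => deriv_fun_add (hf.2.1 x) (hg.2.1 x)
    rw [this]
    exact ih hf.2.2 hg.2.2

/-- One decaying factor suffices: rate 0 for the other means only that its derivatives are bounded.
-/
theorem DerivBound.mul {𝕂 : Type*} [NormedRing 𝕂] [NormedAlgebra ℝ 𝕂] {f g : ℝ → 𝕂}
    (hf : DerivBound 0 k f) (hg : DerivBound C k g) : DerivBound C k fun x => f x * g x := by
  have key : ∀ f g : ℝ → 𝕂, (∃ A, ∀ x, ‖f x‖ ≤ A * exp (-0 * |x|)) →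
      (∃ A, ∀ x, ‖g x‖ ≤ A * exp (-C * |x|)) →
      ∃ A, ∀ x, ‖f x * g x‖ ≤ A * exp (-C * |x|) := by
    rintro f g ⟨A, hA⟩ ⟨B, hB⟩
    have hA0 : 0 ≤ A := by simpa using (norm_nonneg _).trans (hA 0)
    refine ⟨A * B, fun x => (norm_mul_le _ _).trans ?_⟩
    rw [mul_assoc]
    exact mul_le_mul (by simpa using hA x) (hB x) (norm_nonneg _) hA0
  induction k generalizing f g with
  | zero => exact key f g hf hg
  | succ k ih =>
    refine ⟨key f g hf.1 hg.1, hf.2.1.mul hg.2.1, ?_⟩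
    have : deriv (fun x => f x * g x) = fun x => deriv f x * g x + f x * deriv g x :=
      funext fun x => deriv_fun_mul (hf.2.1 x) (hg.2.1 x)
    rw [this]
    exact (ih hf.2.2 hg.of_succ).add (ih hf.of_succ hg.2.2)

theorem DerivBound.ofReal {f : ℝ → ℝ} (h : DerivBound C k f) :
    DerivBound C k fun x => (f x : ℂ) := by
  induction k generalizing f with
  | zero => simpa [DerivBound] using h
  | succ k ih =>
    refine ⟨by simpa using h.1, fun x => (h.2.1 x).hasDerivAt.ofReal_comp.differentiableAt, ?_⟩
    have : deriv (fun x => (f x : ℂ)) = fun x => ((deriv f x : ℝ) : ℂ) :=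
      funext fun x => (h.2.1 x).hasDerivAt.ofReal_comp.deriv
    rw [this]
    exact ih h.2.2

theorem DerivBound.inv {f : ℝ → ℝ} {δ : ℝ} (h : DerivBound 0 k f) (hδ : 0 < δ)
    (hf : ∀ x, δ ≤ f x) : DerivBound 0 k fun x => (f x)⁻¹ := by
  have h0 : ∃ A, ∀ x, ‖(f x)⁻¹‖ ≤ A * exp (-0 * |x|) := by
    refine ⟨δ⁻¹, fun x => ?_⟩
    rw [norm_inv, norm_of_nonneg (hδ.le.trans (hf x))]
    simpa using inv_anti₀ hδ (hf x)
  have hne : ∀ x, f x ≠ 0 := fun x => (hδ.trans_le (hf x)).ne'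
  induction k with
  | zero => exact h0
  | succ k ih =>
    refine ⟨h0, fun x => (h.2.1 x).inv (hne x), ?_⟩
    have : deriv (fun x => (f x)⁻¹) = fun x => (-1) * (deriv f x * ((f x)⁻¹ * (f x)⁻¹)) := by
      funext x
      refine ((h.2.1 x).hasDerivAt.fun_inv (hne x)).deriv.trans ?_
      have := hne x
      field_simp
    rw [this]
    have hi := ih h.of_succ
    exact (DerivBound.const (-1)).mul (h.2.2.mul (hi.mul hi))

theorem DerivBound.const_mul {f : ℝ → ℝ} (h : DerivBound C k f) (a : ℝ) :
    DerivBound C k fun x => a * f x := (DerivBound.const a).mul h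

end DerivBound

/-! ### Decay of all derivatives of the profile. -/

namespace Admissible

variable {m p κ : ℝ} (h : Admissible m p κ)
include h

theorem exists_den_ge : ∃ δ > 0, ∀ x, δ ≤ p + 2 * κ * profile m p κ x := by
  refine ⟨min p (p + 2 * κ * m), lt_min h.p_pos h.q_pos, fun x => ?_⟩
  have hy := h.profile_mem x
  rcases le_total 0 κ with hκ | hκ
  · refine (min_le_left _ _).trans ?_
    have := mul_nonneg hκ hy.1.le
    linarith
  · refine (min_le_right _ _).trans ?_
    have := mul_nonneg_of_nonpos_of_nonpos hκ (sub_nonpos.2 hy.2)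
    linarith

/-- Induction on the pair (y, y') through y'' = `accel` y, with the rate C fixed before k. -/
theorem exists_derivBound : ∃ C > 0, ∀ k, DerivBound C k (profile m p κ) ∧
    DerivBound C k (profileDeriv m p κ) := by
  obtain ⟨C, hC, A, hA⟩ := h.exists_profile_le_exp
  obtain ⟨δ, hδ, hden⟩ := h.exists_den_ge
  refine ⟨C, hC, fun k => ?_⟩
  have hy0 : ∃ A, ∀ x, ‖profile m p κ x‖ ≤ A * exp (-C * |x|) :=
    ⟨A, fun x => by rw [norm_of_nonneg (h.profile_mem x).1.le]; exact hA x⟩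
  have hy1 : ∃ A, ∀ x, ‖profileDeriv m p κ x‖ ≤ A * exp (-C * |x|) := by
    refine ⟨√(rate m p κ 0) * A, fun x => (h.abs_profileDeriv_le x).trans ?_⟩
    rw [mul_assoc]
    exact mul_le_mul_of_nonneg_left (hA x) (sqrt_nonneg _)
  induction k with
  | zero => exact ⟨hy0, hy1⟩
  | succ k ih =>
    refine ⟨⟨hy0, fun x => (h.hasDerivAt_profile x).differentiableAt, ?_⟩,
      ⟨hy1, fun x => (h.hasDerivAt_profileDeriv x).differentiableAt, ?_⟩⟩
    · rw [h.deriv_profile]; exact ih.2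
    · rw [h.deriv_profileDeriv]
      have hb := ih.1.zero_rate hC.le
      have hP : DerivBound 0 k fun x => p + 2 * κ * profile m p κ x :=
        (DerivBound.const p).add (hb.const_mul (2 * κ))
      have hI := hP.inv hδ hden
      -- A bounded factor times y, so that the last factor alone supplies the decay.
      have e : (fun x => accel m p κ (profile m p κ x)) = fun x =>
          (((2 * m + (-3) * profile m p κ x) * (p + 2 * κ * profile m p κ x) +
            (-2 * κ) * (profile m p κ x * (m + (-1) * profile m p κ x))) *
          ((p + 2 * κ * profile m p κ x)⁻¹ * (p + 2 * κ * profile m p κ x)⁻¹)) *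
          profile m p κ x := by
        funext x
        rw [accel, div_eq_mul_inv, pow_two, mul_inv]
        ring
      rw [e]
      refine DerivBound.mul (DerivBound.mul (DerivBound.add (DerivBound.mul ?_ hP) ?_)
        (hI.mul hI)) ih.1
      · exact (DerivBound.const _).add (hb.const_mul _)
      · exact (hb.mul ((DerivBound.const _).add (hb.const_mul _))).const_mul _

end Admissible

/-! ### Weak derivatives of functions of class `C¹` -/

theorem isWeakDeriv_deriv {u : ℝ → ℂ} (hu : ContDiff ℝ 1 u) : IsWeakDeriv u (deriv u) := by
  intro φ hφ hc
  have hφ1 : ContDiff ℝ 1 φ := hφ.of_le (by exact_mod_cast le_top)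
  have hd : ∀ x, HasDerivAt (fun x => φ x • u x) (φ x • deriv u x + deriv φ x • u x) x :=
    fun x => ((hφ1.differentiable one_ne_zero x).hasDerivAt).smul
      ((hu.differentiable one_ne_zero x).hasDerivAt)
  have cu' : Continuous (deriv u) := hu.continuous_deriv le_rfl
  have cφ' : Continuous (deriv φ) := hφ1.continuous_deriv le_rfl
  have i1 : Integrable fun x => φ x • deriv u x :=
    (hφ.continuous.smul cu').integrable_of_hasCompactSupport hc.smul_right
  have i2 : Integrable fun x => deriv φ x • u x :=
    (cφ'.smul hu.continuous).integrable_of_hasCompactSupport hc.deriv.smul_right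
  have i3 : Integrable fun x => φ x • u x :=
    (hφ.continuous.smul hu.continuous).integrable_of_hasCompactSupport hc.smul_right
  have := integral_eq_zero_of_hasDerivAt_of_integrable hd (i1.add i2) i3
  rw [integral_add i1 i2] at this
  exact eq_neg_of_add_eq_zero_right this

/-- Weak derivatives are unique almost everywhere, so the one in the definition of the energy space
is the classical derivative. -/
theorem memLp_deriv_of_mem_energySpace {u : ℝ → ℂ} (hu : ContDiff ℝ 1 u)
    (h : u ∈ energySpace) : MemLp (deriv u) 2 volume := by
  obtain ⟨-, -, w, hw, hwL⟩ := h
  have cu' : Continuous (deriv u) := hu.continuous_deriv le_rfl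
  have : ∀ᵐ x, w x = deriv u x := by
    refine ae_eq_of_integral_contDiff_smul_eq (hwL.locallyIntegrable (by norm_num))
      cu'.locallyIntegrable fun g hg hgc => ?_
    have h1 := hw g hg hgc
    rw [isWeakDeriv_deriv hu g hg hgc] at h1
    exact (neg_injective h1).symm
  exact hwL.ae_eq this

/-! ### Conservation laws -/

/-- The intensity `1 - |u|²`. -/
def intensity (u : ℝ → ℂ) (x : ℝ) : ℝ := 1 - ‖u x‖ ^ 2

theorem intensity_eq (u : ℝ → ℂ) (x : ℝ) :
    intensity u x = 1 - ((u x).re ^ 2 + (u x).im ^ 2) := by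
  rw [intensity, Complex.sq_norm, Complex.normSq_apply]
  ring

theorem intensity_le_one (u : ℝ → ℂ) (x : ℝ) : intensity u x ≤ 1 := by
  have := sq_nonneg ‖u x‖
  unfold intensity
  linarith

theorem hasDerivAt_re {u : ℝ → ℂ} {u' : ℂ} {x : ℝ} (h : HasDerivAt u u' x) :
    HasDerivAt (fun x => (u x).re) u'.re x :=
  Complex.reCLM.hasFDerivAt.comp_hasDerivAt x h

theorem hasDerivAt_im {u : ℝ → ℂ} {u' : ℂ} {x : ℝ} (h : HasDerivAt u u' x) :
    HasDerivAt (fun x => (u x).im) u'.im x :=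
  Complex.imCLM.hasFDerivAt.comp_hasDerivAt x h

/-! ### Derivatives of the intensity. -/

section C2

variable {u : ℝ → ℂ} (hu : ContDiff ℝ 2 u)
include hu

theorem hasDerivAt_of_contDiff_two (x : ℝ) : HasDerivAt u (deriv u x) x :=
  (hu.differentiable two_ne_zero x).hasDerivAt

theorem contDiff_one_deriv : ContDiff ℝ 1 (deriv u) :=
  (contDiff_succ_iff_deriv (n := 1).1 (by simpa [one_add_one_eq_two] using hu)).2.2

theorem hasDerivAt_deriv_of_contDiff_two (x : ℝ) :
    HasDerivAt (deriv u) (deriv (deriv u) x) x :=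
  ((contDiff_one_deriv hu).differentiable one_ne_zero x).hasDerivAt

theorem hasDerivAt_intensity (x : ℝ) : HasDerivAt (intensity u)
    (-2 * ((u x).re * (deriv u x).re + (u x).im * (deriv u x).im)) x := by
  have h := hasDerivAt_of_contDiff_two hu x
  have := (((hasDerivAt_re h).pow 2).add ((hasDerivAt_im h).pow 2)).const_sub 1
  have e : intensity u = fun x => 1 - ((u x).re ^ 2 + (u x).im ^ 2) := funext (intensity_eq u)
  rw [e]
  refine this.congr_deriv ?_
  simp
  ring

theorem deriv_intensity (x : ℝ) : deriv (intensity u) x =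
    -2 * ((u x).re * (deriv u x).re + (u x).im * (deriv u x).im) :=
  (hasDerivAt_intensity hu x).deriv

theorem hasDerivAt_deriv_intensity (x : ℝ) : HasDerivAt (deriv (intensity u))
    (-2 * ((deriv u x).re ^ 2 + (deriv u x).im ^ 2 + (u x).re * (deriv (deriv u) x).re
      + (u x).im * (deriv (deriv u) x).im)) x := by
  have h := hasDerivAt_of_contDiff_two hu x
  have h' := hasDerivAt_deriv_of_contDiff_two hu x
  rw [funext (deriv_intensity hu)]
  refine ((((hasDerivAt_re h).mul (hasDerivAt_re h')).add
    ((hasDerivAt_im h).mul (hasDerivAt_im h'))).const_mul (-2)).congr_deriv ?_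
  ring

theorem hasDerivAt_deriv_intensity' (x : ℝ) :
    HasDerivAt (deriv (intensity u)) (deriv (deriv (intensity u)) x) x :=
  (hasDerivAt_deriv_intensity hu x).differentiableAt.hasDerivAt

theorem deriv_deriv_intensity (x : ℝ) : deriv (deriv (intensity u)) x =
    -2 * ((deriv u x).re ^ 2 + (deriv u x).im ^ 2 + (u x).re * (deriv (deriv u) x).re
      + (u x).im * (deriv (deriv u) x).im) :=
  (hasDerivAt_deriv_intensity hu x).deriv

theorem continuous_intensity : Continuous (intensity u) :=
  continuous_iff_continuousAt.2 fun x => (hasDerivAt_intensity hu x).continuousAt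

theorem continuous_deriv_intensity : Continuous (deriv (intensity u)) :=
  continuous_iff_continuousAt.2 fun x => (hasDerivAt_deriv_intensity hu x).continuousAt

theorem continuous_deriv_deriv_intensity : Continuous (deriv (deriv (intensity u))) := by
  have h0 := hu.continuous
  have h1 := (contDiff_one_deriv hu).continuous
  have h2 := (contDiff_one_deriv hu).continuous_deriv le_rfl
  have e : deriv (deriv (intensity u)) = _ := funext (deriv_deriv_intensity hu)
  rw [e]
  have := Complex.continuous_re
  have := Complex.continuous_im
  fun_prop

end C2

theorem twEquation_iff {c κ : ℝ} {u : ℝ → ℂ} : TWEquation c κ u ↔ ∀ x,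
    (-c * (deriv u x).im + (deriv (deriv u) x).re + (u x).re * intensity u x
      + κ * (u x).re * deriv (deriv (intensity u)) x = 0) ∧
    (c * (deriv u x).re + (deriv (deriv u) x).im + (u x).im * intensity u x
      + κ * (u x).im * deriv (deriv (intensity u)) x = 0) := by
  unfold TWEquation
  refine forall_congr' fun x => ?_
  change Complex.I * (c : ℂ) * deriv u x + deriv (deriv u) x + u x * ((intensity u x : ℝ) : ℂ)
    + (κ : ℂ) * u x * ((deriv (deriv (intensity u)) x : ℝ) : ℂ) = 0 ↔ _
  rw [Complex.ext_iff]
  simp [Complex.add_re, Complex.mul_re, Complex.mul_im]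

/-! ### First integrals of finite energy solutions. -/

namespace IsSmoothSol

variable {c κ : ℝ} {u : ℝ → ℂ} (h : IsSmoothSol c κ u)
include h

theorem integrable_intensity_sq : Integrable fun x => intensity u x ^ 2 :=
  (memLp_two_iff_integrable_sq (continuous_intensity h.1).aestronglyMeasurable).1 h.2.1.2.1

theorem integrable_norm_deriv_sq : Integrable fun x => ‖deriv u x‖ ^ 2 :=
  (memLp_two_iff_integrable_sq_norm (contDiff_one_deriv h.1).continuous.aestronglyMeasurable).1
    (memLp_deriv_of_mem_energySpace (h.1.of_le (by norm_num)) h.2.1)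

/-- Here |η'| ≤ 2|u||u'| ≤ (1 + |u|²)|u'|, and 1 + |u|² = 2 - η. -/
theorem abs_deriv_intensity_le (x : ℝ) :
    |deriv (intensity u) x| ≤ (2 - intensity u x) * ‖deriv u x‖ := by
  have hn : ‖deriv u x‖ ^ 2 = (deriv u x).re ^ 2 + (deriv u x).im ^ 2 := by
    rw [Complex.sq_norm, Complex.normSq_apply]; ring
  have h2 : 0 ≤ 2 - intensity u x := by linarith [intensity_le_one u x]
  refine abs_le_of_sq_le_sq ?_ (mul_nonneg h2 (norm_nonneg _))
  rw [mul_pow, hn, deriv_intensity h.1, intensity_eq]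
  generalize (u x).re = a
  generalize (u x).im = b
  generalize (deriv u x).re = s
  generalize (deriv u x).im = t
  have e : (2 - (1 - (a ^ 2 + b ^ 2))) ^ 2 * (s ^ 2 + t ^ 2) - (-2 * (a * s + b * t)) ^ 2
      = (1 - (a ^ 2 + b ^ 2)) ^ 2 * (s ^ 2 + t ^ 2) + 4 * (a * t - b * s) ^ 2 := by ring
  have : 0 ≤ (1 - (a ^ 2 + b ^ 2)) ^ 2 * (s ^ 2 + t ^ 2) + 4 * (a * t - b * s) ^ 2 := by
    positivity
  linarith

/-- No bound on |u| is available yet, so (η²)' is not visibly integrable. Dividing by 2 - η = 1 +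
|u|² ≥ 1 repairs this: Ψ = η²/(2 - η) is integrable and |Ψ'| ≤ 3|η||u'| is too, whence Ψ → 0. Then
η² = Ψ(2 - η) ≤ 2Ψ + Ψ|η| gives |η| ≤ Ψ + √(2Ψ). -/
theorem tendsto_intensity : Tendsto (intensity u) (cocompact ℝ) (𝓝 0) := by
  set η := intensity u with hη
  have hle := intensity_le_one u
  have hpos : ∀ x, 0 < 2 - η x := fun x => by have := hle x; linarith
  have cη := continuous_intensity h.1
  have cη' := continuous_deriv_intensity h.1
  set Ψ := fun x => η x ^ 2 / (2 - η x) with hΨ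
  set Ψ' := fun x => η x * deriv η x * (4 - η x) / (2 - η x) ^ 2 with hΨ'
  have hd : ∀ x, HasDerivAt Ψ (Ψ' x) x := by
    intro x
    have h1 : HasDerivAt η (deriv η x) x := (hasDerivAt_intensity h.1 x).differentiableAt.hasDerivAt
    refine ((h1.pow 2).div (h1.const_sub 2) (hpos x).ne').congr_deriv ?_
    simp only [hΨ']
    congr 1
    simp
    ring
  have iΨ : Integrable Ψ := by
    refine h.integrable_intensity_sq.mono' ?_ (Eventually.of_forall fun x => ?_)
    · exact (Continuous.div (by fun_prop) (by fun_prop)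
        fun x => (hpos x).ne').aestronglyMeasurable
    · rw [norm_of_nonneg (div_nonneg (sq_nonneg _) (hpos x).le)]
      exact div_le_self (sq_nonneg _) (by have := hle x; linarith)
  have iΨ' : Integrable Ψ' := by
    refine ((h.integrable_intensity_sq.add h.integrable_norm_deriv_sq).const_mul 2).mono' ?_
      (Eventually.of_forall fun x => ?_)
    · exact (Continuous.div (by fun_prop) (by fun_prop)
        fun x => (pow_pos (hpos x) 2).ne').aestronglyMeasurable
    · have h1 := h.abs_deriv_intensity_le x
      have hp := hpos x
      have hx : η x ≤ 1 := hle x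
      simp only [hΨ', norm_eq_abs, abs_div, abs_mul, abs_pow, abs_of_pos hp, Pi.add_apply]
      rw [div_le_iff₀ (by positivity), abs_of_pos (by linarith : 0 < 4 - η x)]
      have h3 : (4 - η x) ≤ 3 * (2 - η x) := by linarith
      have h4 : |η x| * |deriv η x| * (4 - η x)
          ≤ |η x| * ((2 - η x) * ‖deriv u x‖) * (3 * (2 - η x)) := by gcongr; linarith
      have h5 : 3 * (|η x| * ‖deriv u x‖) ≤ 2 * (intensity u x ^ 2 + ‖deriv u x‖ ^ 2) := by
        rw [← hη, ← sq_abs (η x)]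
        nlinarith [sq_nonneg (|η x| - ‖deriv u x‖)]
      have h6 := mul_le_mul_of_nonneg_right h5 (sq_nonneg (2 - η x))
      linarith
  have tΨ : Tendsto Ψ (cocompact ℝ) (𝓝 0) := by
    rw [cocompact_eq_atBot_atTop]
    exact (tendsto_zero_of_hasDerivAt_of_integrableOn_Iic (a := 0) (fun x _ => hd x)
      iΨ'.integrableOn iΨ.integrableOn).sup
      (tendsto_zero_of_hasDerivAt_of_integrableOn_Ioi (a := 0) (fun x _ => hd x)
      iΨ'.integrableOn iΨ.integrableOn)
  have t2 : Tendsto (fun x => Ψ x + √(2 * Ψ x)) (cocompact ℝ) (𝓝 0) := by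
    simpa using tΨ.add (tΨ.const_mul 2).sqrt
  refine squeeze_zero_norm (fun x => ?_) t2
  have hΨ0 : 0 ≤ Ψ x := div_nonneg (sq_nonneg _) (hpos x).le
  have e : |η x| ^ 2 = Ψ x * (2 - η x) := by
    simp only [hΨ, sq_abs]
    rw [div_mul_cancel₀ _ (hpos x).ne']
  have hs := sq_sqrt (by positivity : 0 ≤ 2 * Ψ x)
  have hs0 := sqrt_nonneg (2 * Ψ x)
  rw [norm_eq_abs]
  by_contra! hlt
  have := neg_abs_le (η x)
  nlinarith [mul_le_mul_of_nonneg_left this hΨ0]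

theorem exists_norm_bound : ∃ B, ∀ x, ‖u x‖ ^ 2 ≤ B := by
  have := h.tendsto_intensity.eventually_const_le (by norm_num : (-1 : ℝ) < 0)
  obtain ⟨K, hK, hKs⟩ := mem_cocompact.1 this
  obtain ⟨B, hB⟩ := hK.exists_bound_of_continuousOn (continuous_intensity h.1).continuousOn
  refine ⟨max 2 (1 + B), fun x => ?_⟩
  have e : ‖u x‖ ^ 2 = 1 - intensity u x := by simp [intensity]
  by_cases hx : x ∈ K
  · have h1 := hB x hx
    rw [norm_eq_abs] at h1
    have := neg_abs_le (intensity u x)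
    exact le_max_of_le_right (by linarith)
  · have h1 : -1 ≤ intensity u x := hKs hx
    exact le_max_of_le_left (by linarith)

/-- The imaginary part of ū times the equation is an exact derivative. The square of the conserved
constant is at most 2B|u'|² + c²η²/2, which is integrable on ℝ, so the constant is zero. -/
theorem momentum (x : ℝ) :
    (u x).re * (deriv u x).im - (u x).im * (deriv u x).re = c / 2 * intensity u x := by
  obtain ⟨B, hB⟩ := h.exists_norm_bound
  set K := fun x => (u x).re * (deriv u x).im - (u x).im * (deriv u x).re
    - c / 2 * intensity u x with hK
  have hd : ∀ x, HasDerivAt K 0 x := by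
    intro x
    have h0 := hasDerivAt_of_contDiff_two h.1 x
    have h1 := hasDerivAt_deriv_of_contDiff_two h.1 x
    obtain ⟨e1, e2⟩ := twEquation_iff.1 h.2.2 x
    refine ((((hasDerivAt_re h0).mul (hasDerivAt_im h1)).sub
      ((hasDerivAt_im h0).mul (hasDerivAt_re h1))).sub
      ((hasDerivAt_intensity h.1 x).const_mul (c / 2))).congr_deriv ?_
    linear_combination (u x).re * e2 - (u x).im * e1
  have hc : ∀ x, K x = K 0 := fun x =>
    is_const_of_deriv_eq_zero (fun x => (hd x).differentiableAt) (fun x => (hd x).deriv) x 0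
  have hi : Integrable fun _ : ℝ => K 0 ^ 2 := by
    refine ((h.integrable_norm_deriv_sq.const_mul (2 * B)).add
      (h.integrable_intensity_sq.const_mul (c ^ 2 / 2))).mono' aestronglyMeasurable_const
      (Eventually.of_forall fun x => ?_)
    rw [norm_of_nonneg (sq_nonneg _), ← hc x, hK]
    have hn : ‖deriv u x‖ ^ 2 = (deriv u x).re ^ 2 + (deriv u x).im ^ 2 := by
      rw [Complex.sq_norm, Complex.normSq_apply]; ring
    have hn' : ‖u x‖ ^ 2 = (u x).re ^ 2 + (u x).im ^ 2 := by
      rw [Complex.sq_norm, Complex.normSq_apply]; ring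
    have hb := mul_le_mul_of_nonneg_right (hB x) (sq_nonneg ‖deriv u x‖)
    simp only [Pi.add_apply]
    have h1 : ((u x).re * (deriv u x).im - (u x).im * (deriv u x).re) ^ 2
        ≤ ‖u x‖ ^ 2 * ‖deriv u x‖ ^ 2 := by
      rw [hn, hn']
      linarith [sq_nonneg ((u x).re * (deriv u x).re + (u x).im * (deriv u x).im)]
    nlinarith [sq_nonneg ((u x).re * (deriv u x).im - (u x).im * (deriv u x).re
      + c / 2 * intensity u x)]
  have h0 : K 0 ^ 2 = 0 := by
    rcases integrable_const_iff.1 hi with h0 | h0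
    · exact h0
    · have := h0.measure_univ_lt_top
      simp at this
  have := hc x
  rw [pow_eq_zero_iff two_ne_zero] at h0
  rw [h0] at this
  simp only [hK] at this
  linarith

/-- The real part of ū' times the equation is an exact derivative. The constant is integrable on ℝ
because |η'|² ≤ 4B|u'|², hence zero. -/
theorem energy (x : ℝ) : ‖deriv u x‖ ^ 2
    = intensity u x ^ 2 / 2 + κ * deriv (intensity u) x ^ 2 / 2 := by
  obtain ⟨B, hB⟩ := h.exists_norm_bound
  have hn : ∀ x, ‖deriv u x‖ ^ 2 = (deriv u x).re ^ 2 + (deriv u x).im ^ 2 := fun x => by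
    rw [Complex.sq_norm, Complex.normSq_apply]; ring
  set K := fun x => (deriv u x).re ^ 2 + (deriv u x).im ^ 2
    - (intensity u x ^ 2 / 2 + κ * deriv (intensity u) x ^ 2 / 2) with hK
  have hd : ∀ x, HasDerivAt K 0 x := by
    intro x
    have h1 := hasDerivAt_deriv_of_contDiff_two h.1 x
    obtain ⟨e1, e2⟩ := twEquation_iff.1 h.2.2 x
    refine ((((hasDerivAt_re h1).pow 2).add ((hasDerivAt_im h1).pow 2)).sub
      ((((hasDerivAt_intensity h.1 x).pow 2).div_const 2).add
        ((((hasDerivAt_deriv_intensity' h.1 x).pow 2).const_mul κ).div_const 2))).congr_deriv ?_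
    simp only [Nat.cast_ofNat, Nat.add_one_sub_one, pow_one]
    linear_combination 2 * (deriv u x).re * e1 + 2 * (deriv u x).im * e2
      - κ * deriv (deriv (intensity u)) x * deriv_intensity h.1 x
  have hc : ∀ x, K x = K 0 := fun x =>
    is_const_of_deriv_eq_zero (fun x => (hd x).differentiableAt) (fun x => (hd x).deriv) x 0
  have hi : Integrable fun _ : ℝ => K 0 := by
    refine ((h.integrable_norm_deriv_sq.const_mul (1 + 2 * |κ| * B)).add
      (h.integrable_intensity_sq.const_mul (1 / 2))).mono' aestronglyMeasurable_const
      (Eventually.of_forall fun x => ?_)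
    have hn' : ‖u x‖ ^ 2 = (u x).re ^ 2 + (u x).im ^ 2 := by
      rw [Complex.sq_norm, Complex.normSq_apply]; ring
    have hb := mul_le_mul_of_nonneg_right (hB x) (sq_nonneg ‖deriv u x‖)
    have h1 : deriv (intensity u) x ^ 2 ≤ 4 * (B * ‖deriv u x‖ ^ 2) := by
      rw [deriv_intensity h.1]
      rw [hn, hn'] at hb
      rw [hn]
      linarith [sq_nonneg ((u x).re * (deriv u x).im - (u x).im * (deriv u x).re)]
    have h2 := mul_le_mul_of_nonneg_left h1 (abs_nonneg κ)
    have h3 := mul_le_mul_of_nonneg_right (le_abs_self κ) (sq_nonneg (deriv (intensity u) x))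
    have h4 := mul_le_mul_of_nonneg_right (neg_abs_le κ) (sq_nonneg (deriv (intensity u) x))
    rw [norm_eq_abs, ← hc x, hK, abs_le]
    simp only [← hn]
    have h5 := sq_nonneg ‖deriv u x‖
    have h6 := sq_nonneg (intensity u x)
    simp only [Pi.add_apply]
    constructor <;> linarith
  have h0 : K 0 = 0 := by
    rcases integrable_const_iff.1 hi with h0 | h0
    · exact h0
    · have := h0.measure_univ_lt_top
      simp at this
  have := hc x
  rw [h0] at this
  simp only [hK] at this
  rw [hn]
  linarith

/-- Substitute both conservation laws in Re(ū u')² + Im(ū u')² = |u|²|u'|². -/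
theorem deriv_intensity_sq (x : ℝ) :
    deriv (intensity u) x ^ 2 * (1 - 2 * κ + 2 * κ * intensity u x)
      = intensity u x ^ 2 * (2 - c ^ 2 - 2 * intensity u x) := by
  have hm := h.momentum x
  have he := h.energy x
  have hn : ‖deriv u x‖ ^ 2 = (deriv u x).re ^ 2 + (deriv u x).im ^ 2 := by
    rw [Complex.sq_norm, Complex.normSq_apply]; ring
  have hi := intensity_eq u x
  have hd := deriv_intensity h.1 x
  rw [hn] at he
  set a := (u x).re
  set b := (u x).im
  set s := (deriv u x).re
  set t := (deriv u x).im
  set n := intensity u x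
  set d := deriv (intensity u) x
  have hm2 : (a * t - b * s) ^ 2 = (c / 2 * n) ^ 2 := by rw [hm]
  have hd2 : d ^ 2 = (-2 * (a * s + b * t)) ^ 2 := by rw [hd]
  have hi2 : a ^ 2 + b ^ 2 = 1 - n := by linarith
  have e : d ^ 2 / 4 + (c / 2 * n) ^ 2 = (1 - n) * (n ^ 2 / 2 + κ * d ^ 2 / 2) := by
    rw [← hm2, ← he, ← hi2, hd2]; ring
  linear_combination 4 * e

/-- Obtained from η'' = -2(|u'|² + Re(ū u'')) and the equation. Differentiating the first-order law
would require division by η', which is impossible at the extremum. -/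
theorem deriv_deriv_intensity_eq (x : ℝ) :
    deriv (deriv (intensity u)) x * (1 - 2 * κ + 2 * κ * intensity u x)
      + κ * deriv (intensity u) x ^ 2
      = (2 - c ^ 2) * intensity u x - 3 * intensity u x ^ 2 := by
  have hm := h.momentum x
  have he := h.energy x
  have hn : ‖deriv u x‖ ^ 2 = (deriv u x).re ^ 2 + (deriv u x).im ^ 2 := by
    rw [Complex.sq_norm, Complex.normSq_apply]; ring
  have hi := intensity_eq u x
  have hd := deriv_deriv_intensity h.1 x
  obtain ⟨e1, e2⟩ := twEquation_iff.1 h.2.2 x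
  rw [hn] at he
  have hi2 : (u x).re ^ 2 + (u x).im ^ 2 = 1 - intensity u x := by linarith
  linear_combination hd - 2 * he - 2 * (u x).re * e1 - 2 * (u x).im * e2 - 2 * c * hm
    + 2 * (intensity u x + κ * deriv (deriv (intensity u)) x) * hi2

/-- At a point where the intensity is extremal, it vanishes or equals `1 - c²/2`. -/
theorem intensity_eq_of_deriv_eq_zero {x : ℝ} (hx : deriv (intensity u) x = 0) :
    intensity u x = 0 ∨ intensity u x = 1 - c ^ 2 / 2 := by
  have := h.deriv_intensity_sq x
  rw [hx] at this
  rcases mul_eq_zero.1 (by linarith : intensity u x ^ 2 *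
    (2 - c ^ 2 - 2 * intensity u x) = 0) with h1 | h1
  · exact Or.inl (by simpa using h1)
  · exact Or.inr (by linarith)

/-- Since η → 0 at infinity, a positive value forces an attained maximum, which is a nonzero
critical value. -/
theorem exists_max {x₁ : ℝ} (hx : 0 < intensity u x₁) : ∃ x₀, (∀ x, intensity u x ≤ 1 - c ^ 2 / 2) ∧
    0 < 1 - c ^ 2 / 2 ∧ intensity u x₀ = 1 - c ^ 2 / 2 ∧ deriv (intensity u) x₀ = 0 := by
  obtain ⟨x₀, hx₀⟩ := (continuous_intensity h.1).exists_forall_ge' x₁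
    (h.tendsto_intensity.eventually_le_const hx)
  have hd : deriv (intensity u) x₀ = 0 :=
    IsLocalMax.deriv_eq_zero (Eventually.of_forall hx₀)
  have hpos := hx.trans_le (hx₀ x₁)
  have he := (h.intensity_eq_of_deriv_eq_zero hd).resolve_left hpos.ne'
  exact ⟨x₀, fun x => he ▸ hx₀ x, he ▸ hpos, he, hd⟩

theorem exists_min {x₁ : ℝ} (hx : intensity u x₁ < 0) : ∃ x₀, (∀ x, 1 - c ^ 2 / 2 ≤ intensity u x) ∧
    1 - c ^ 2 / 2 < 0 ∧ intensity u x₀ = 1 - c ^ 2 / 2 ∧ deriv (intensity u) x₀ = 0 := by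
  obtain ⟨x₀, hx₀⟩ := (continuous_intensity h.1).exists_forall_le' x₁
    (h.tendsto_intensity.eventually_const_le hx)
  have hd : deriv (intensity u) x₀ = 0 :=
    IsLocalMin.deriv_eq_zero (Eventually.of_forall hx₀)
  have hneg := (hx₀ x₁).trans_lt hx
  have he := (h.intensity_eq_of_deriv_eq_zero hd).resolve_left hneg.ne
  exact ⟨x₀, fun x => he ▸ hx₀ x, he ▸ hneg, he, hd⟩

theorem isTrivial_of_intensity (h0 : ∀ x, intensity u x = 0) : IsTrivial u := by
  have e : intensity u = fun _ => 0 := funext h0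
  have hd : ∀ x, deriv u x = 0 := by
    intro x
    have := h.energy x
    rw [e] at this
    simpa using this
  have hc : ∀ x, u x = u 0 := fun x =>
    is_const_of_deriv_eq_zero (h.1.differentiable two_ne_zero) hd x 0
  have hn : ‖u 0‖ = 1 := by
    have := h0 0
    unfold intensity at this
    have h1 : ‖u 0‖ ^ 2 = 1 := by linarith
    exact (pow_eq_one_iff_of_nonneg (norm_nonneg _) two_ne_zero).1 h1
  obtain ⟨φ, hφ⟩ := (Complex.norm_eq_one_iff _).1 hn
  exact ⟨φ, fun x => by rw [hc x, hφ]⟩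

end IsSmoothSol

/-! ### Nonexistence -/

/-- For `κ = 1/2` the profile equation only has compactly supported or periodic solutions, the
former not being of class `C²`. -/
theorem IsSmoothSol.intensity_eq_zero_of_kappa_eq_half {c : ℝ} {u : ℝ → ℂ}
    (h : IsSmoothSol c (1 / 2) u) (hM : 1 - c ^ 2 / 2 ≠ 0) (x₁ : ℝ) : intensity u x₁ = 0 := by
  by_contra hx₁
  set M := 1 - c ^ 2 / 2 with hMdef
  have cη := continuous_intensity h.1
  have cη₂ := continuous_deriv_deriv_intensity h.1
  have E1 := h.deriv_intensity_sq
  have E2 := h.deriv_deriv_intensity_eq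
  have hd1 := hasDerivAt_deriv_intensity' h.1
  set η := intensity u
  set d := deriv η
  set d₂ := deriv d
  -- Both laws carry a factor η when κ = 1/2; it can be cancelled away from the zeros of η.
  have hne : ∀ x, η x ≠ 0 → d₂ x = M - 2 * η x := by
    intro x hx
    have h1 : d x ^ 2 = η x * (2 * M - 2 * η x) := by
      apply mul_right_cancel₀ hx
      linear_combination E1 x
    apply mul_right_cancel₀ hx
    linear_combination E2 x - h1 / 2
  have hz : ∀ x, η x = 0 → d x = 0 := by
    intro x hx
    have := E2 x
    rw [hx] at this
    have h1 : d x ^ 2 = 0 := by linear_combination 2 * this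
    simpa using h1
  -- The set is closed by continuity. It is open at a zero of η lying in it: there η'' = M ≠ 0, so
  -- η' has no other zero nearby, and zeros of η are zeros of η'.
  have hS : {x | d₂ x = M - 2 * η x} = univ := by
    refine IsClopen.eq_univ ⟨isClosed_eq cη₂ (by fun_prop), ?_⟩ ⟨x₁, hne x₁ hx₁⟩
    rw [isOpen_iff_mem_nhds]
    intro x hx
    by_cases hx0 : η x = 0
    · have hx' : d₂ x = M := by
        have : d₂ x = M - 2 * η x := hx
        rw [this, hx0]; ring
      have := (hd1 x).eventually_ne (c := 0) (by rw [hx']; exact hM)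
      rw [eventually_nhdsWithin_iff] at this
      filter_upwards [this] with y hy
      by_cases hyx : y = x
      · rw [hyx]; exact hx
      · exact hne y fun hy0 => hy hyx (hz y hy0)
    · filter_upwards [cη.continuousAt.eventually_ne hx0] with y hy
      exact hne y hy
  have hall : ∀ x, d₂ x = M - 2 * η x := fun x => eq_univ_iff_forall.1 hS x
  have hdsq : ∀ x, d x ^ 2 = η x * (2 * M - 2 * η x) := by
    intro x
    by_cases hx : η x = 0
    · rw [hz x hx, hx]; ring
    · apply mul_right_cancel₀ hx
      linear_combination E1 x
  have tη : Tendsto η atTop (𝓝 0) := h.tendsto_intensity.mono_left atTop_le_cocompact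
  have td : Tendsto (fun x => d x ^ 2) atTop (𝓝 0) := by
    simp only [hdsq]
    simpa using tη.mul ((tη.const_mul 2).const_sub (2 * M))
  -- At infinity η and η' tend to 0 while η'' tends to M ≠ 0, against the mean value theorem on [X,
  -- X + 1]. With the margin |M|/8 one gets |M| < |M|/4 + |M|/4.
  have hMp : 0 < |M| := abs_pos.2 hM
  have ev1 := tη.abs.eventually_lt_const (by simpa using by positivity : |(0 : ℝ)| < |M| / 8)
  have ev2 := td.eventually_lt_const (by positivity : 0 < (|M| / 8) ^ 2)
  obtain ⟨X, hX⟩ := eventually_atTop.1 (ev1.and ev2)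
  obtain ⟨ξ, hξ, hξe⟩ := exists_hasDerivAt_eq_slope d d₂ (by linarith : X < X + 1)
    (fun x _ => (hd1 x).continuousAt.continuousWithinAt) fun x _ => hd1 x
  have a1 := abs_lt_of_sq_lt_sq (hX X le_rfl).2 (by positivity)
  have a2 := abs_lt_of_sq_lt_sq (hX (X + 1) (by linarith)).2 (by positivity)
  have a3 := (hX ξ hξ.1.le).1
  rw [hall] at hξe
  have e : M = 2 * η ξ + (d (X + 1) - d X) := by
    have : (X + 1 - X) = 1 := by ring
    rw [this, div_one] at hξe
    linarith
  have h1 : |M| ≤ |2 * η ξ| + (|d (X + 1)| + |d X|) := by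
    conv_lhs => rw [e]
    exact (abs_add_le _ _).trans (add_le_add_right (abs_sub _ _) _)
  rw [abs_mul, abs_two] at h1
  linarith

namespace IsSmoothSol

variable {c κ : ℝ} {u : ℝ → ℂ} (h : IsSmoothSol c κ u)
include h

theorem exists_intensity_eq_of_pos {x₀ ε : ℝ} (hε : 0 < ε) (hx₀ : ε ≤ intensity u x₀) :
    ∃ x, intensity u x = ε := by
  obtain ⟨x₁, hx₁⟩ := (h.tendsto_intensity.eventually_le_const hε).exists
  exact mem_range_of_exists_le_of_exists_ge (continuous_intensity h.1) ⟨x₁, hx₁⟩ ⟨x₀, hx₀⟩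

theorem exists_intensity_eq_of_neg {x₀ ε : ℝ} (hε : ε < 0) (hx₀ : intensity u x₀ ≤ ε) :
    ∃ x, intensity u x = ε := by
  obtain ⟨x₁, hx₁⟩ := (h.tendsto_intensity.eventually_const_le hε).exists
  exact mem_range_of_exists_le_of_exists_ge (continuous_intensity h.1) ⟨x₀, hx₀⟩ ⟨x₁, hx₁⟩

theorem isTrivial_of_notMem (hc : 0 ≤ c) (hD : (c, κ) ∉ D) : IsTrivial u := by
  apply h.isTrivial_of_intensity
  intro x₁
  have h2 : √2 ^ 2 = 2 := sq_sqrt (by norm_num)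
  by_contra hx₁
  rcases lt_or_gt_of_ne hx₁ with hx | hx
  · obtain ⟨x₀, -, hM, hx₀, -⟩ := h.exists_min hx
    have hc2 : √2 < c := by
      apply lt_of_pow_lt_pow_left₀ 2 hc
      linarith
    have hκ : κ ≤ 1 / 2 := by
      by_contra! hκ
      exact hD (Or.inr ⟨hc2, hκ⟩)
    rcases hκ.eq_or_lt with rfl | hκ
    · exact hx₁ (h.intensity_eq_zero_of_kappa_eq_half hM.ne x₁)
    -- Small enough that 2 - c² - 2η < 0 ≤ 1 - 2κ + 2κη at η = -δ; the scalar law then equates a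
    -- nonnegative number with a negative one.
    · set δ := min (-(1 - c ^ 2 / 2) / 2) ((1 - 2 * κ) / (2 * (|κ| + 1)))
      have hκ1 : 0 < |κ| + 1 := by positivity
      have hδ : 0 < δ := lt_min (by linarith) (div_pos (by linarith) (by positivity))
      have hδ1 : δ ≤ -(1 - c ^ 2 / 2) / 2 := min_le_left _ _
      have hδ2 : δ * (2 * (|κ| + 1)) ≤ 1 - 2 * κ :=
        (le_div_iff₀ (by positivity)).1 (min_le_right _ _)
      have hδ3 := mul_le_mul_of_nonneg_left (le_abs_self κ) hδ.le
      obtain ⟨x, hxε⟩ := h.exists_intensity_eq_of_neg (x₀ := x₀) (neg_lt_zero.2 hδ)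
        (by linarith)
      have E1 := h.deriv_intensity_sq x
      rw [hxε] at E1
      have hP : 0 ≤ 1 - 2 * κ + 2 * κ * -δ := by linarith
      have := mul_nonneg (sq_nonneg (deriv (intensity u) x)) hP
      have hQ : 0 < (-δ) ^ 2 * -(2 - c ^ 2 - 2 * -δ) :=
        mul_pos (by rw [neg_sq]; positivity) (by linarith)
      linarith
  · obtain ⟨x₀, -, hM, hx₀, -⟩ := h.exists_max hx
    have hc2 : c < √2 := by
      apply lt_of_pow_lt_pow_left₀ 2 (sqrt_nonneg _)
      linarith
    have hκ : 1 / 2 ≤ κ := by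
      by_contra! hκ
      rcases le_or_gt κ 0 with hκ0 | hκ0
      · exact hD (Or.inl (Or.inr ⟨hc, hc2, hκ0⟩))
      · exact hD (Or.inl (Or.inl ⟨hc, hc2, hκ0, hκ⟩))
    rcases hκ.eq_or_lt with rfl | hκ
    · exact hx₁ (h.intensity_eq_zero_of_kappa_eq_half hM.ne' x₁)
    -- Small enough that 1 - 2κ + 2κη ≤ 0 < 2 - c² - 2η at η = ε.
    · set ε := min ((1 - c ^ 2 / 2) / 2) ((2 * κ - 1) / (4 * κ))
      have hε : 0 < ε := lt_min (by linarith) (div_pos (by linarith) (by linarith))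
      have hε1 : ε ≤ (1 - c ^ 2 / 2) / 2 := min_le_left _ _
      have hε2 : ε * (4 * κ) ≤ 2 * κ - 1 := (le_div_iff₀ (by linarith)).1 (min_le_right _ _)
      obtain ⟨x, hxε⟩ := h.exists_intensity_eq_of_pos (x₀ := x₀) hε (by linarith)
      have E1 := h.deriv_intensity_sq x
      rw [hxε] at E1
      have hP : 0 ≤ -(1 - 2 * κ + 2 * κ * ε) := by linarith
      have := mul_nonneg (sq_nonneg (deriv (intensity u) x)) hP
      have hQ : 0 < ε ^ 2 * (2 - c ^ 2 - 2 * ε) := mul_pos (by positivity) (by linarith)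
      linarith

end IsSmoothSol

/-! ### The intensity profile in terms of the profile equation -/

/-- The intensity `η_{c,κ}` is `s` times the profile with parameters `m`, `p`, `κ`. -/
structure EtaData (c κ s m p : ℝ) : Prop where
  adm : Admissible m p κ
  sign : s = 1 ∨ s = -1
  mul_m : s * m = 1 - c ^ 2 / 2
  mul_p : s * p = 1 - 2 * κ
  eta_eq : ∀ x, eta c κ x = s * profile m p κ x

theorem admissible_of_mem_D₁_union_D₂ {c κ : ℝ} (h : (c, κ) ∈ D₁ ∪ D₂) :
    Admissible (1 - c ^ 2 / 2) (1 - 2 * κ) κ := by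
  have h2 : √2 ^ 2 = 2 := sq_sqrt (by norm_num)
  have hc : 0 ≤ c ∧ c < √2 := by rcases h with h | h <;> exact ⟨h.1, h.2.1⟩
  have hc2 : c ^ 2 < 2 := by rw [← h2]; exact pow_lt_pow_left₀ hc.2 hc.1 two_ne_zero
  have hκ : κ < 1 / 2 := by
    rcases h with h | h
    · exact h.2.2.2
    · have : κ ≤ 0 := h.2.2
      linarith
  refine ⟨by linarith, by linarith, ?_⟩
  have e : 1 - 2 * κ + 2 * κ * (1 - c ^ 2 / 2) = 1 - κ * c ^ 2 := by ring
  rw [e]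
  rcases le_or_gt κ 0 with h0 | h0
  · nlinarith [sq_nonneg c]
  · nlinarith [sq_nonneg c]

theorem admissible_of_mem_D₃ {c κ : ℝ} (h : (c, κ) ∈ D₃) :
    Admissible (c ^ 2 / 2 - 1) (2 * κ - 1) κ := by
  have h2 : √2 ^ 2 = 2 := sq_sqrt (by norm_num)
  have hc2 : 2 < c ^ 2 := by rw [← h2]; exact pow_lt_pow_left₀ h.1 (sqrt_nonneg _) two_ne_zero
  have hκ : 1 / 2 < κ := h.2
  refine ⟨by linarith, by linarith, ?_⟩
  -- The sum to be shown positive equals κc² - 1.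
  nlinarith

theorem funF_eq_profileTime {c κ : ℝ} (hκ : 0 < κ) :
    funF c κ = profileTime (1 - c ^ 2 / 2) (1 - 2 * κ) κ := by
  funext y
  have e : 2 * (1 - c ^ 2 / 2) = 2 - c ^ 2 := by ring
  rw [funF, profileTime, timeCorrection, if_pos hκ, rate, e]

theorem funG_eq_profileTime {c κ : ℝ} (hκ : κ ≤ 0) :
    funG c κ = profileTime (1 - c ^ 2 / 2) (1 - 2 * κ) κ := by
  funext y
  have e : 2 * (1 - c ^ 2 / 2) = 2 - c ^ 2 := by ring
  rw [funG, profileTime, timeCorrection, if_neg (not_lt.2 hκ), rate, e]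

/-- Passing to -y reverses the sign of both numerator and denominator of every quotient. -/
theorem funH_eq_profileTime {c κ : ℝ} (hκ : 0 < κ) (y : ℝ) :
    funH c κ y = profileTime (c ^ 2 / 2 - 1) (2 * κ - 1) κ (-y) := by
  have e : 2 * (c ^ 2 / 2 - 1) = -(2 - c ^ 2) := by ring
  have e1 : 2 * κ - 1 = -(1 - 2 * κ) := by ring
  have e2 : -(2 - c ^ 2) - 2 * -y = -(2 - c ^ 2 - 2 * y) := by ring
  have e3 : -(1 - 2 * κ) + 2 * κ * -y = -(1 - 2 * κ + 2 * κ * y) := by ring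
  rw [funH, funF, profileTime, timeCorrection, if_pos hκ, rate, e, e1, e2, e3, neg_div_neg_eq,
    neg_div_neg_eq, neg_mul_neg, neg_mul_neg]

theorem bijOn_neg_intervalJ (c : ℝ) : BijOn Neg.neg (intervalJ c) (Ioc 0 (c ^ 2 / 2 - 1)) := by
  refine ⟨fun x hx => ?_, neg_injective.injOn, fun y hy => ⟨-y, ?_, neg_neg y⟩⟩
  · have h1 : 1 - c ^ 2 / 2 ≤ x := hx.1
    exact ⟨neg_pos.2 hx.2, by linarith⟩
  · exact ⟨by linarith [hy.2], neg_lt_zero.2 hy.1⟩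

theorem bijOn_funF {c κ : ℝ} (h : (c, κ) ∈ D₁) : BijOn (funF c κ) (intervalI c) (Ici 0) := by
  rw [funF_eq_profileTime h.2.2.1]
  exact (admissible_of_mem_D₁_union_D₂ (Or.inl h)).bijOn_profileTime

theorem bijOn_funG {c κ : ℝ} (h : (c, κ) ∈ D₂) : BijOn (funG c κ) (intervalI c) (Ici 0) := by
  rw [funG_eq_profileTime h.2.2]
  exact (admissible_of_mem_D₁_union_D₂ (Or.inr h)).bijOn_profileTime

theorem bijOn_funH {c κ : ℝ} (h : (c, κ) ∈ D₃) : BijOn (funH c κ) (intervalJ c) (Ici 0) := by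
  have hκ : (0 : ℝ) < κ := by linarith [h.2]
  have : funH c κ = profileTime (c ^ 2 / 2 - 1) (2 * κ - 1) κ ∘ Neg.neg :=
    funext (funH_eq_profileTime hκ)
  rw [this]
  exact (admissible_of_mem_D₃ h).bijOn_profileTime.comp (bijOn_neg_intervalJ c)

theorem etaData_of_mem_D₁_union_D₂ {c κ : ℝ} (h : (c, κ) ∈ D₁ ∪ D₂) :
    EtaData c κ 1 (1 - c ^ 2 / 2) (1 - 2 * κ) := by
  refine ⟨admissible_of_mem_D₁_union_D₂ h, Or.inl rfl, one_mul _, one_mul _, fun x => ?_⟩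
  rw [one_mul, eta]
  by_cases h1 : (c, κ) ∈ D₁
  · rw [if_pos h1, funF_eq_profileTime h1.2.2.1]
    rfl
  · have h2 := h.resolve_left h1
    rw [if_neg h1, if_pos h2, funG_eq_profileTime h2.2.2]
    rfl

theorem etaData_of_mem_D₃ {c κ : ℝ} (h : (c, κ) ∈ D₃) :
    EtaData c κ (-1) (c ^ 2 / 2 - 1) (2 * κ - 1) := by
  have hA := admissible_of_mem_D₃ h
  refine ⟨hA, Or.inr rfl, by ring, by ring, fun x => ?_⟩
  have h1 : (c, κ) ∉ D₁ := fun h' => lt_asymm h'.2.1 h.1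
  have h2 : (c, κ) ∉ D₂ := fun h' => lt_asymm h'.2.1 h.1
  rw [eta, if_neg h1, if_neg h2]
  have hs := (bijOn_funH h).surjOn (abs_nonneg x)
  have hmem : evenInverse (funH c κ) (intervalJ c) x ∈ intervalJ c := Function.invFunOn_mem hs
  have heq : funH c κ (evenInverse (funH c κ) (intervalJ c) x) = |x| := Function.invFunOn_eq hs
  have hκ : (0 : ℝ) < κ := by linarith [h.2]
  rw [funH_eq_profileTime hκ] at heq
  have := (hA.profile_eq_iff ((bijOn_neg_intervalJ c).mapsTo hmem)).2 heq.symm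
  rw [this]
  ring

theorem exists_etaData {c κ : ℝ} (h : (c, κ) ∈ D) : ∃ s m p, EtaData c κ s m p := by
  rcases h with h | h
  · exact ⟨_, _, _, etaData_of_mem_D₁_union_D₂ h⟩
  · exact ⟨_, _, _, etaData_of_mem_D₃ h⟩

/-! ### Uniqueness -/

theorem Admissible.exists_lipschitzOnWith_accel {m p κ : ℝ} (h : Admissible m p κ) :
    ∃ K, LipschitzOnWith K (accel m p κ) (Icc 0 m) := by
  have : ContDiffOn ℝ 1 (accel m p κ) (Icc 0 m) := by
    unfold accel
    exact ContDiffOn.div (by fun_prop) (by fun_prop) fun y hy => (pow_pos (h.den_pos hy) 2).ne'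
  exact this.exists_lipschitzOnWith one_ne_zero (convex_Icc 0 m) isCompact_Icc

/-- The first-order law alone does not determine y, since the constant m satisfies it too. Together
the two laws give y'' = `accel` y, whose right side is Lipschitz on [0, m], and uniqueness follows
from the data at 0. -/
theorem Admissible.eq_profile {m p κ : ℝ} (h : Admissible m p κ) {y y₁ y₂ : ℝ → ℝ}
    (hy : ∀ x, HasDerivAt y (y₁ x) x) (hy₁ : ∀ x, HasDerivAt y₁ (y₂ x) x)
    (hmem : ∀ x, y x ∈ Icc 0 m) (e₀ : y 0 = m) (e₁ : y₁ 0 = 0)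
    (E1 : ∀ x, y₁ x ^ 2 * (p + 2 * κ * y x) = 2 * y x ^ 2 * (m - y x))
    (E2 : ∀ x, y₂ x * (p + 2 * κ * y x) + κ * y₁ x ^ 2 = 2 * m * y x - 3 * y x ^ 2) :
    y = profile m p κ := by
  have hacc : ∀ x, y₂ x = accel m p κ (y x) := by
    intro x
    rw [accel, eq_div_iff (pow_pos (h.den_pos (hmem x)) 2).ne']
    linear_combination (p + 2 * κ * y x) * E2 x - κ * E1 x
  obtain ⟨K, hK⟩ := h.exists_lipschitzOnWith_accel
  have hv : ∀ _ : ℝ, LipschitzOnWith (max 1 (K * 1)) (fun z : ℝ × ℝ => (z.2, accel m p κ z.1))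
      (Icc 0 m ×ˢ univ) := fun _ =>
    (LipschitzWith.prod_snd.lipschitzOnWith).prodMk
      (hK.comp LipschitzWith.prod_fst.lipschitzOnWith fun z hz => hz.1)
  have := ODE_solution_unique_univ (v := fun _ z => (z.2, accel m p κ z.1)) (t₀ := 0)
    (s := fun _ => Icc 0 m ×ˢ univ) (f := fun x => (y x, y₁ x))
    (g := fun x => (profile m p κ x, profileDeriv m p κ x)) hv
    (fun x => ⟨by simpa [← hacc] using (hy x).prodMk (hy₁ x), hmem x, mem_univ _⟩)
    (fun x => ⟨(h.hasDerivAt_profile x).prodMk (h.hasDerivAt_profileDeriv x),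
      h.profile_mem_Icc x, mem_univ _⟩)
    (by simp [e₀, e₁, h.profile_zero, h.profileDeriv_zero])
  funext x
  exact (Prod.ext_iff.1 (congrFun this x)).1

/-- The bound on the potential q makes the first-order system for (u, u') globally Lipschitz,
uniformly in x. -/
theorem linear_ode_unique {c A : ℝ} {q : ℝ → ℝ} (hq : ∀ x, |q x| ≤ A) {u u₁ v v₁ : ℝ → ℂ}
    (hu : ∀ x, HasDerivAt u (u₁ x) x)
    (hu₁ : ∀ x, HasDerivAt u₁ (-(Complex.I * c * u₁ x + u x * q x)) x)
    (hv : ∀ x, HasDerivAt v (v₁ x) x)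
    (hv₁ : ∀ x, HasDerivAt v₁ (-(Complex.I * c * v₁ x + v x * q x)) x)
    (h₀ : u 0 = v 0) (h₁ : u₁ 0 = v₁ 0) : u = v := by
  have hA : 0 ≤ A := (abs_nonneg _).trans (hq 0)
  have hL : ∀ t : ℝ, LipschitzOnWith (Real.toNNReal (1 + |c| + A))
      (fun z : ℂ × ℂ => (z.2, -(Complex.I * c * z.2 + z.1 * q t))) univ := by
    intro t
    apply LipschitzWith.lipschitzOnWith
    refine LipschitzWith.of_dist_le_mul fun z w => ?_
    rw [Real.coe_toNNReal _ (by positivity), dist_eq_norm, dist_eq_norm]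
    have e : (z.2, -(Complex.I * c * z.2 + z.1 * q t)) - (w.2, -(Complex.I * c * w.2 + w.1 * q t))
        = ((z - w).2, -(Complex.I * c * (z - w).2 + (z - w).1 * q t)) := by
      refine Prod.ext rfl ?_
      simp only [Prod.snd_sub, Prod.fst_sub]
      ring
    rw [e]
    generalize z - w = d
    have d1 := norm_fst_le d
    have d2 := norm_snd_le d
    have hd := norm_nonneg d
    have hc := abs_nonneg c
    rw [Prod.norm_mk]
    refine max_le ?_ ?_
    · nlinarith [mul_nonneg hc hd, mul_nonneg hA hd]
    · rw [norm_neg]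
      refine (norm_add_le _ _).trans ?_
      rw [norm_mul, norm_mul, norm_mul, Complex.norm_I, Complex.norm_real, Complex.norm_real,
        norm_eq_abs, norm_eq_abs, one_mul]
      have h1 : |c| * ‖d.2‖ ≤ |c| * ‖d‖ := by gcongr
      have h2 : ‖d.1‖ * |q t| ≤ ‖d‖ * A := by gcongr; exact hq t
      nlinarith
  have := ODE_solution_unique_univ
    (v := fun t (z : ℂ × ℂ) => (z.2, -(Complex.I * c * z.2 + z.1 * q t))) (t₀ := 0)
    (s := fun _ => univ) (f := fun x => (u x, u₁ x)) (g := fun x => (v x, v₁ x)) hL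
    (fun x => ⟨(hu x).prodMk (hu₁ x), mem_univ _⟩)
    (fun x => ⟨(hv x).prodMk (hv₁ x), mem_univ _⟩) (by simp [h₀, h₁])
  funext x
  exact (Prod.ext_iff.1 (congrFun this x)).1

namespace EtaData

variable {c κ s m p : ℝ} (h : EtaData c κ s m p)
include h

theorem sq_sign : s * s = 1 := by rcases h.sign with h | h <;> rw [h] <;> norm_num

theorem eta_fun_eq : eta c κ = fun x => s * profile m p κ x := funext h.eta_eq

theorem hasDerivAt_eta (x : ℝ) : HasDerivAt (eta c κ) (s * profileDeriv m p κ x) x := by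
  rw [h.eta_fun_eq]
  exact (h.adm.hasDerivAt_profile x).const_mul s

theorem deriv_eta : deriv (eta c κ) = fun x => s * profileDeriv m p κ x :=
  funext fun x => (h.hasDerivAt_eta x).deriv

theorem hasDerivAt_deriv_eta (x : ℝ) :
    HasDerivAt (deriv (eta c κ)) (s * accel m p κ (profile m p κ x)) x := by
  rw [h.deriv_eta]
  exact (h.adm.hasDerivAt_profileDeriv x).const_mul s

theorem deriv_deriv_eta :
    deriv (deriv (eta c κ)) = fun x => s * accel m p κ (profile m p κ x) :=
  funext fun x => (h.hasDerivAt_deriv_eta x).deriv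

theorem exists_derivBound : ∃ C > 0, ∀ k, DerivBound C k (eta c κ) ∧
    DerivBound C k (deriv (eta c κ)) ∧ DerivBound C k (deriv (deriv (eta c κ))) := by
  obtain ⟨C, hC, hb⟩ := h.adm.exists_derivBound
  have key : ∀ k, DerivBound C k (deriv (eta c κ)) := fun k => by
    rw [h.deriv_eta]; exact (hb k).2.const_mul s
  refine ⟨C, hC, fun k => ⟨?_, key k, (key (k + 1)).2.2⟩⟩
  rw [h.eta_fun_eq]
  exact (hb k).1.const_mul s

theorem eta_zero : eta c κ 0 = 1 - c ^ 2 / 2 := by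
  rw [h.eta_eq, h.adm.profile_zero, h.mul_m]

theorem deriv_eta_zero : deriv (eta c κ) 0 = 0 := by
  simp [h.deriv_eta, h.adm.profileDeriv_zero]

theorem eta_zero_ne : eta c κ 0 ≠ 0 := by
  rw [h.eta_eq, h.adm.profile_zero]
  have := h.sq_sign
  exact mul_ne_zero (fun h0 => by rw [h0] at this; norm_num at this) h.adm.m_pos.ne'

theorem deriv_eta_sq (x : ℝ) : deriv (eta c κ) x ^ 2 * (1 - 2 * κ + 2 * κ * eta c κ x)
    = eta c κ x ^ 2 * (2 - c ^ 2 - 2 * eta c κ x) := by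
  have e := h.adm.profileDeriv_sq x
  have hs := h.sq_sign
  have e1 : 2 - c ^ 2 = 2 * (s * m) := by rw [h.mul_m]; ring
  rw [h.deriv_eta, h.eta_eq, ← h.mul_p, e1]
  linear_combination s ^ 3 * e

theorem deriv_deriv_eta_eq (x : ℝ) :
    deriv (deriv (eta c κ)) x * (1 - 2 * κ + 2 * κ * eta c κ x) + κ * deriv (eta c κ) x ^ 2
      = (2 - c ^ 2) * eta c κ x - 3 * eta c κ x ^ 2 := by
  have e := h.adm.profileDeriv_sq x
  have hs := h.sq_sign
  have e1 : 2 - c ^ 2 = 2 * (s * m) := by rw [h.mul_m]; ring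
  have hP := h.adm.den_profile_pos x
  have ha : accel m p κ (profile m p κ x) * (p + 2 * κ * profile m p κ x)
      + κ * profileDeriv m p κ x ^ 2 = 2 * m * profile m p κ x - 3 * profile m p κ x ^ 2 := by
    apply mul_right_cancel₀ hP.ne'
    rw [add_mul, mul_assoc κ, e, accel]
    generalize profile m p κ x = y at *
    rw [mul_assoc, ← pow_two, div_mul_cancel₀ _ (pow_pos hP 2).ne']
    ring
  rw [h.deriv_deriv_eta, h.deriv_eta, h.eta_eq, ← h.mul_p, e1]
  linear_combination s ^ 2 * ha

theorem contDiff_eta : ContDiff ℝ (⊤ : ℕ∞) (eta c κ) := by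
  rw [h.eta_fun_eq]
  exact contDiff_const.mul h.adm.contDiff_profile

/-- The intensity of a nontrivial solution is a translate of the intensity profile. -/
theorem exists_translate {v : ℝ → ℂ} (hv : IsSmoothSol c κ v) (hnt : ¬ IsTrivial v) :
    ∃ x₀, ∀ x, intensity v (x + x₀) = eta c κ x := by
  obtain ⟨x₁, hx₁⟩ : ∃ x, intensity v x ≠ 0 := by
    by_contra! h0
    exact hnt (hv.isTrivial_of_intensity h0)
  have hm := h.adm.m_pos
  have hs := h.sq_sign
  have hM := h.mul_m
  obtain ⟨x₀, hmem, h0, h1⟩ : ∃ x₀, (∀ x, s * intensity v x ∈ Icc 0 m) ∧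
      -- The intensity cannot take the sign opposite to s: an extremum of that sign would again have
      -- value 1 - c²/2 = sm.
      intensity v x₀ = 1 - c ^ 2 / 2 ∧ deriv (intensity v) x₀ = 0 := by
    rcases h.sign with rfl | rfl
    · have hge : ∀ x, 0 ≤ intensity v x := by
        by_contra! hneg
        obtain ⟨x, hx⟩ := hneg
        obtain ⟨_, _, hlt, _⟩ := hv.exists_min hx
        linarith
      obtain ⟨x₀, hle, -, h0, h1⟩ := hv.exists_max ((hge x₁).lt_of_ne' hx₁)
      exact ⟨x₀, fun x => ⟨by linarith [hge x], by linarith [hle x]⟩, h0, h1⟩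
    · have hle : ∀ x, intensity v x ≤ 0 := by
        by_contra! hpos
        obtain ⟨x, hx⟩ := hpos
        obtain ⟨_, _, hlt, _⟩ := hv.exists_max hx
        linarith
      obtain ⟨x₀, hge, -, h0, h1⟩ := hv.exists_min ((hle x₁).lt_of_ne hx₁)
      exact ⟨x₀, fun x => ⟨by linarith [hle x], by linarith [hge x]⟩, h0, h1⟩
  refine ⟨x₀, fun x => ?_⟩
  have e1 : 2 - c ^ 2 = 2 * (s * m) := by rw [hM]; ring
  have hd0 : ∀ x, HasDerivAt (fun x => s * intensity v (x + x₀))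
      (s * deriv (intensity v) (x + x₀)) x := fun x =>
    ((hasDerivAt_intensity hv.1 (x + x₀)).differentiableAt.hasDerivAt.comp_add_const
      x x₀).const_mul s
  have hd1 : ∀ x, HasDerivAt (fun x => s * deriv (intensity v) (x + x₀))
      (s * deriv (deriv (intensity v)) (x + x₀)) x := fun x =>
    ((hasDerivAt_deriv_intensity' hv.1 (x + x₀)).comp_add_const x x₀).const_mul s
  have key := h.adm.eq_profile hd0 hd1 (fun x => hmem (x + x₀))
    (by simp only [zero_add]; rw [h0, ← hM, ← mul_assoc, hs, one_mul])
    (by simp only [zero_add]; rw [h1, mul_zero])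
    (fun x => by
      have E1 := hv.deriv_intensity_sq (x + x₀)
      rw [← h.mul_p, e1] at E1
      generalize deriv (intensity v) (x + x₀) = d at *
      generalize intensity v (x + x₀) = n at *
      linear_combination s * E1 + (2 * κ * n * d ^ 2 + 2 * n ^ 3) * s * hs)
    (fun x => by
      have E2 := hv.deriv_deriv_intensity_eq (x + x₀)
      rw [← h.mul_p, e1] at E2
      generalize deriv (deriv (intensity v)) (x + x₀) = d₂ at *
      generalize deriv (intensity v) (x + x₀) = d at *
      generalize intensity v (x + x₀) = n at *
      linear_combination E2 + (2 * κ * n * d₂ + κ * d ^ 2 + 3 * n ^ 2) * hs)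
  have : s * intensity v (x + x₀) = profile m p κ x := congrFun key x
  rw [h.eta_eq, ← this, ← mul_assoc, hs, one_mul]

/-- Supplies the bounded potential for `linear_ode_unique`. -/
theorem exists_forcing_bound :
    ∃ A, ∀ x, |eta c κ x + κ * deriv (deriv (eta c κ)) x| ≤ A := by
  obtain ⟨C, hC, hb⟩ := h.exists_derivBound
  obtain ⟨A₁, h₁⟩ := ((hb 0).1.zero_rate hC.le).exists_bound
  obtain ⟨A₂, h₂⟩ := ((hb 0).2.2.zero_rate hC.le).exists_bound
  refine ⟨A₁ + |κ| * A₂, fun x => (abs_add_le _ _).trans ?_⟩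
  have e₁ := h₁ x
  have e₂ := h₂ x
  simp only [norm_eq_abs, neg_zero, zero_mul, exp_zero, mul_one] at e₁ e₂
  rw [abs_mul]
  gcongr

end EtaData

theorem norm_sq_of_intensity_eq {c : ℝ} {u : ℝ → ℂ} {x : ℝ} (hx : intensity u x = 1 - c ^ 2 / 2) :
    ‖u x‖ ^ 2 = c ^ 2 / 2 := by
  unfold intensity at hx
  linarith

/-- With the intensity regarded as known, the equation is linear in u. -/
theorem TWEquation.hasDerivAt_deriv {c κ : ℝ} {u : ℝ → ℂ} (hu : ContDiff ℝ 2 u)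
    (h : TWEquation c κ u) (x : ℝ) : HasDerivAt (deriv u) (-(Complex.I * c * deriv u x + u x *
      ((intensity u x + κ * deriv (deriv (intensity u)) x : ℝ) : ℂ))) x := by
  refine (hasDerivAt_deriv_of_contDiff_two hu x).congr_deriv ?_
  have e := h x
  change Complex.I * (c : ℂ) * deriv u x + deriv (deriv u) x + u x * ((intensity u x : ℝ) : ℂ)
    + (κ : ℂ) * u x * ((deriv (deriv (intensity u)) x : ℝ) : ℂ) = 0 at e
  push_cast
  linear_combination e

namespace IsSmoothSol

variable {c κ : ℝ} {u : ℝ → ℂ} (h : IsSmoothSol c κ u)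
include h

/-- At an extremal point of the intensity the solution moves orthogonally to itself. -/
theorem deriv_eq_of_extremal (hc : c ≠ 0) {x : ℝ} (hx : intensity u x = 1 - c ^ 2 / 2)
    (hd : deriv (intensity u) x = 0) :
    deriv u x = (((1 - c ^ 2 / 2) / c : ℝ) : ℂ) * Complex.I * u x := by
  have hm := h.momentum x
  have hn := norm_sq_of_intensity_eq hx
  rw [Complex.sq_norm, Complex.normSq_apply] at hn
  rw [deriv_intensity h.1] at hd
  rw [hx] at hm
  have hc2 : c ^ 2 ≠ 0 := pow_ne_zero 2 hc
  have hK : (1 - c ^ 2 / 2) / c * c = 1 - c ^ 2 / 2 := div_mul_cancel₀ _ hc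
  rw [← hK] at hm
  generalize (1 - c ^ 2 / 2) / c = K at hm ⊢
  apply Complex.ext
  · simp only [Complex.mul_re, Complex.mul_im, Complex.ofReal_re, Complex.ofReal_im, Complex.I_re,
      Complex.I_im]
    apply mul_left_cancel₀ hc2
    linear_combination (-2 * (deriv u x).re) * hn - (u x).re * hd - 2 * (u x).im * hm
  · simp only [Complex.mul_re, Complex.mul_im, Complex.ofReal_re, Complex.ofReal_im, Complex.I_re,
      Complex.I_im]
    apply mul_left_cancel₀ hc2
    linear_combination (-2 * (deriv u x).im) * hn - (u x).im * hd + 2 * (u x).re * hm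

/-- For c ≠ 0 an extremum has |u|² = c²/2 and u' is a fixed multiple of u. For c = 0 it has u = 0,
and the energy law fixes |u'| ≠ 0. In both cases one phase matches the two sets of data. -/
theorem exists_phase {v : ℝ → ℂ} (hv : IsSmoothSol c κ v) {x y : ℝ}
    (hx : intensity u x = 1 - c ^ 2 / 2) (hdx : deriv (intensity u) x = 0)
    (hy : intensity v y = 1 - c ^ 2 / 2) (hdy : deriv (intensity v) y = 0) :
    ∃ φ : ℝ, v y = Complex.exp (φ * Complex.I) * u x ∧
      deriv v y = Complex.exp (φ * Complex.I) * deriv u x := by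
  have nx := norm_sq_of_intensity_eq hx
  have ny := norm_sq_of_intensity_eq hy
  have key : ∀ z w : ℂ, z ≠ 0 → ‖z‖ ^ 2 = ‖w‖ ^ 2 →
      ∃ φ : ℝ, w = Complex.exp (φ * Complex.I) * z := by
    intro z w hz hzw
    have hzn : ‖z‖ ≠ 0 := norm_ne_zero_iff.2 hz
    have e : ‖w‖ = ‖z‖ := ((sq_eq_sq₀ (norm_nonneg _) (norm_nonneg _)).1 hzw).symm
    obtain ⟨φ, hφ⟩ := (Complex.norm_eq_one_iff (w / z)).1 (by
      rw [norm_div, e, div_self hzn])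
    exact ⟨φ, by rw [hφ, div_mul_cancel₀ _ hz]⟩
  by_cases hc : c = 0
  · have ex := h.energy x
    have ey := hv.energy y
    rw [hx, hdx] at ex
    rw [hy, hdy] at ey
    have hu0 : u x = 0 := by simpa [hc] using nx
    have hv0 : v y = 0 := by simpa [hc] using ny
    have hne : deriv u x ≠ 0 := by
      intro h0
      rw [h0, hc] at ex
      norm_num at ex
    obtain ⟨φ, hφ⟩ := key _ _ hne (ex.trans ey.symm)
    exact ⟨φ, by rw [hu0, hv0, mul_zero], hφ⟩
  · have hne : u x ≠ 0 := by
      intro h0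
      rw [h0] at nx
      simp only [norm_zero] at nx
      have := pow_ne_zero 2 hc
      apply this
      linarith
    obtain ⟨φ, hφ⟩ := key _ _ hne (nx.trans ny.symm)
    refine ⟨φ, hφ, ?_⟩
    rw [h.deriv_eq_of_extremal hc hx hdx, hv.deriv_eq_of_extremal hc hy hdy, hφ]
    ring

end IsSmoothSol

/-- A single solution with intensity η suffices: after a translation and a phase, any other
nontrivial one solves the same linear equation with the same data at 0. -/
theorem EtaData.isUniqueNontrivialSol {c κ s m p : ℝ} (h : EtaData c κ s m p) {u : ℝ → ℂ}
    (hu : IsSmoothSol c κ u) (hη : intensity u = eta c κ) : IsUniqueNontrivialSol c κ u := by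
  refine ⟨hu, ?_, fun v hv hnt => ?_⟩
  · rintro ⟨φ, hφ⟩
    apply h.eta_zero_ne
    rw [← hη, intensity, hφ, Complex.norm_exp_ofReal_mul_I]
    norm_num
  obtain ⟨x₀, hx₀⟩ := h.exists_translate hv hnt
  have hηv : (fun x => intensity v (x + x₀)) = eta c κ := funext hx₀
  have hd : (fun x => deriv (intensity v) (x + x₀)) = deriv (eta c κ) := by
    rw [← hηv]
    exact funext fun x => (deriv_comp_add_const (f := intensity v) x₀ x).symm
  have hdd : (fun x => deriv (deriv (intensity v)) (x + x₀)) = deriv (deriv (eta c κ)) := by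
    rw [← hd]
    exact funext fun x => (deriv_comp_add_const (f := deriv (intensity v)) x₀ x).symm
  have h0 := congrFun hηv 0
  have h1 := congrFun hd 0
  simp only [zero_add, h.eta_zero, h.deriv_eta_zero] at h0 h1
  obtain ⟨φ, hφ, hφ'⟩ := hu.exists_phase hv (x := 0) (y := x₀) (by rw [hη, h.eta_zero])
    (by rw [hη, h.deriv_eta_zero]) h0 h1
  obtain ⟨A, hA⟩ := h.exists_forcing_bound
  have key := linear_ode_unique (c := c) hA
    (u := fun x => v (x + x₀)) (u₁ := fun x => deriv v (x + x₀))
    (v := fun x => Complex.exp (φ * Complex.I) * u x)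
    (v₁ := fun x => Complex.exp (φ * Complex.I) * deriv u x)
    (fun x => (hasDerivAt_of_contDiff_two hv.1 (x + x₀)).comp_add_const x x₀)
    (fun x => by
      have := (hv.2.2.hasDerivAt_deriv hv.1 (x + x₀)).comp_add_const x x₀
      rw [hx₀ x, congrFun hdd x] at this
      exact this)
    (fun x => (hasDerivAt_of_contDiff_two hu.1 x).const_mul _)
    (fun x => by
      have := (hu.2.2.hasDerivAt_deriv hu.1 x).const_mul (Complex.exp (φ * Complex.I))
      rw [hη] at this
      refine this.congr_deriv ?_
      ring)
    (by simpa using hφ) (by simpa using hφ')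
  refine ⟨x₀, φ, fun x => ?_⟩
  have := congrFun key (x - x₀)
  simpa using this

/-! ### Existence -/

theorem integrable_exp_neg_mul_abs {C : ℝ} (hC : 0 < C) :
    Integrable fun x : ℝ => exp (-C * |x|) := by
  rw [← integrableOn_univ, ← Iic_union_Ioi (a := (0 : ℝ))]
  refine IntegrableOn.union ?_ ?_
  · refine (integrableOn_exp_mul_Iic hC 0).congr_fun (fun x hx => ?_) measurableSet_Iic
    simp only [abs_of_nonpos (mem_Iic.1 hx)]
    ring_nf
  · refine (exp_neg_integrableOn_Ioi 0 hC).congr_fun (fun x hx => ?_) measurableSet_Ioi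
    simp only [abs_of_pos (mem_Ioi.1 hx)]

theorem memLp_two_of_le_exp {E : Type*} [NormedAddCommGroup E] {f : ℝ → E} (hf : Continuous f)
    {A C : ℝ} (hC : 0 < C) (h : ∀ x, ‖f x‖ ≤ A * exp (-C * |x|)) : MemLp f 2 volume := by
  rw [memLp_two_iff_integrable_sq_norm hf.aestronglyMeasurable]
  refine ((integrable_exp_neg_mul_abs (by positivity : 0 < 2 * C)).const_mul (A ^ 2)).mono'
    (by fun_prop) (Eventually.of_forall fun x => ?_)
  rw [norm_of_nonneg (by positivity)]
  refine (pow_le_pow_left₀ (norm_nonneg _) (h x) 2).trans_eq ?_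
  rw [mul_pow, ← exp_nat_mul]
  congr 2
  push_cast
  ring

theorem exists_deriv_le_exp {c κ C : ℝ} {u : ℝ → ℂ} (h0 : DerivBound C 0 (eta c κ))
    (h1 : DerivBound C 0 (deriv (eta c κ)))
    (hE : ∀ x, ‖deriv u x‖ ^ 2 = eta c κ x ^ 2 / 2 + κ * deriv (eta c κ) x ^ 2 / 2) :
    ∃ A, ∀ x, ‖deriv u x‖ ≤ A * exp (-C * |x|) := by
  obtain ⟨A₀, hA₀⟩ := h0
  obtain ⟨A₁, hA₁⟩ := h1
  refine ⟨√(A₀ ^ 2 + |κ| * A₁ ^ 2), fun x => ?_⟩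
  refine (sq_le_sq₀ (norm_nonneg _) (by positivity)).1 ?_
  rw [mul_pow, sq_sqrt (by positivity), hE]
  have e₀ := pow_le_pow_left₀ (norm_nonneg _) (hA₀ x) 2
  have e₁ := pow_le_pow_left₀ (norm_nonneg _) (hA₁ x) 2
  rw [norm_eq_abs, sq_abs, mul_pow] at e₀ e₁
  have e₂ := mul_le_mul_of_nonneg_left e₁ (abs_nonneg κ)
  have e₃ := mul_le_mul_of_nonneg_right (le_abs_self κ) (sq_nonneg (deriv (eta c κ) x))
  have e₄ := mul_nonneg (abs_nonneg κ) (sq_nonneg (deriv (eta c κ) x))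
  have e₅ := sq_nonneg (eta c κ x)
  linarith

namespace EtaData

variable {c κ s m p : ℝ} (h : EtaData c κ s m p) {u : ℝ → ℂ} (hu : ContDiff ℝ 2 u)
  (hη : intensity u = eta c κ)
  (hE : ∀ x, ‖deriv u x‖ ^ 2 = eta c κ x ^ 2 / 2 + κ * deriv (eta c κ) x ^ 2 / 2)
include h hu hη hE

theorem mem_energySpace : u ∈ energySpace := by
  obtain ⟨C, hC, hb⟩ := h.exists_derivBound
  refine ⟨fun K hK => ?_, ?_, deriv u, isWeakDeriv_deriv (hu.of_le (by norm_num)), ?_⟩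
  · have : IsFiniteMeasure (volume.restrict K) := isFiniteMeasure_restrict.2 hK.measure_ne_top
    obtain ⟨B, hB⟩ := hK.exists_bound_of_continuousOn hu.continuous.continuousOn
    refine MemLp.of_bound hu.continuous.aestronglyMeasurable B ?_
    exact (ae_restrict_iff' hK.measurableSet).2 (Eventually.of_forall hB)
  · obtain ⟨A, hA⟩ := (hb 0).1.exists_bound
    have := memLp_two_of_le_exp h.contDiff_eta.continuous hC hA
    rwa [← hη] at this
  · obtain ⟨A, hA⟩ := exists_deriv_le_exp (hb 0).1 (hb 0).2.1 hE
    exact memLp_two_of_le_exp (contDiff_one_deriv hu).continuous hC hA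

/-- The energy law bounds u' by η and η', and the equation expresses u'' as bounded factors times u'
and times η + κη'', so the bounds propagate with the same rate C. -/
theorem exists_derivBound_deriv (hT : TWEquation c κ u) : ∃ C > 0, ∀ k,
    DerivBound C k (deriv u) ∧ DerivBound C k (eta c κ) := by
  obtain ⟨C, hC, hb⟩ := h.exists_derivBound
  obtain ⟨A, hA⟩ := exists_deriv_le_exp (hb 0).1 (hb 0).2.1 hE
  have hu0 : ∃ B, ∀ x, ‖u x‖ ≤ B * exp (-0 * |x|) := by
    obtain ⟨B, hB⟩ := ((hb 0).1.zero_rate hC.le).exists_bound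
    refine ⟨√(1 + B), fun x => ?_⟩
    have hBx := hB x
    have hi : intensity u x = eta c κ x := congrFun hη x
    simp only [norm_eq_abs, neg_zero, zero_mul, exp_zero, mul_one] at hBx ⊢
    refine le_sqrt_of_sq_le ?_
    unfold intensity at hi
    linarith [neg_abs_le (eta c κ x)]
  refine ⟨C, hC, fun k => ⟨?_, (hb k).1⟩⟩
  induction k with
  | zero => exact ⟨A, hA⟩
  | succ k ih =>
    refine ⟨⟨A, hA⟩, fun x => (hasDerivAt_deriv_of_contDiff_two hu x).differentiableAt, ?_⟩
    have hub : DerivBound 0 k u := DerivBound.of_succ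
      ⟨hu0, fun x => (hasDerivAt_of_contDiff_two hu x).differentiableAt, ih.zero_rate hC.le⟩
    have e : deriv (deriv u) = fun x => (-(Complex.I * c)) * deriv u x + u x *
        (((-1) * (eta c κ x + κ * deriv (deriv (eta c κ)) x) : ℝ) : ℂ) := by
      funext x
      rw [(hT.hasDerivAt_deriv hu x).deriv, hη]
      push_cast
      ring
    rw [e]
    exact ((DerivBound.const _).mul ih).add (hub.mul
      (((hb k).1.add ((hb k).2.2.const_mul κ)).const_mul (-1)).ofReal)

theorem exists_exp_bound (hT : TWEquation c κ u) : ∃ C : ℝ, 0 < C ∧ ∀ k : ℕ, ∃ A : ℝ, 0 < A ∧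
    ∀ x : ℝ, ‖iteratedDeriv k (deriv u) x‖ + |iteratedDeriv k (eta c κ) x|
      ≤ A * Real.exp (-C * |x|) := by
  obtain ⟨C, hC, hb⟩ := h.exists_derivBound_deriv hu hη hE hT
  refine ⟨C, hC, fun k => ?_⟩
  obtain ⟨A, hA⟩ := (hb k).1.exists_bound_iteratedDeriv
  obtain ⟨B, hB⟩ := (hb k).2.exists_bound_iteratedDeriv
  refine ⟨|A| + |B| + 1, by positivity, fun x => ?_⟩
  have e := exp_pos (-C * |x|)
  have h1 := mul_le_mul_of_nonneg_right (le_abs_self A) e.le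
  have h2 := mul_le_mul_of_nonneg_right (le_abs_self B) e.le
  have h3 := hA x
  have h4 := hB x
  rw [norm_eq_abs] at h4
  linarith

end EtaData

/-! ### The solitons of nonzero speed -/

theorem intensity_solitonPos {c κ x : ℝ} (hx : eta c κ x ≤ 1) :
    intensity (solitonPos c κ) x = eta c κ x := by
  rw [intensity, solitonPos, norm_mul, Complex.norm_exp_ofReal_mul_I, mul_one, Complex.norm_real,
    norm_eq_abs, sq_abs, sq_sqrt (by linarith)]
  ring

namespace EtaData

variable {c κ s m p : ℝ} (h : EtaData c κ s m p) (hc : 0 < c)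
include h hc

theorem eta_lt_one (x : ℝ) : eta c κ x < 1 := by
  have hy := h.adm.profile_mem x
  have hM := h.mul_m
  have : 0 < c ^ 2 := by positivity
  rw [h.eta_eq]
  rcases h.sign with rfl | rfl
  · linarith [hy.2]
  · linarith [hy.1]

theorem contDiff_ratio : ContDiff ℝ (⊤ : ℕ∞) fun x => eta c κ x / (1 - eta c κ x) :=
  h.contDiff_eta.div (contDiff_const.sub h.contDiff_eta)
    fun x => (sub_pos.2 (h.eta_lt_one hc x)).ne'

theorem hasDerivAt_theta (x : ℝ) :
    HasDerivAt (theta c κ) (c / 2 * (eta c κ x / (1 - eta c κ x))) x := by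
  have hcont := (h.contDiff_ratio hc).continuous
  exact (intervalIntegral.integral_hasDerivAt_right (hcont.intervalIntegrable _ _)
    (hcont.stronglyMeasurableAtFilter _ _) hcont.continuousAt).const_mul (c / 2)

theorem contDiff_theta : ContDiff ℝ (⊤ : ℕ∞) (theta c κ) := by
  rw [contDiff_infty_iff_deriv]
  refine ⟨fun x => (h.hasDerivAt_theta hc x).differentiableAt, ?_⟩
  rw [funext fun x => (h.hasDerivAt_theta hc x).deriv]
  exact contDiff_const.mul (h.contDiff_ratio hc)

theorem contDiff_solitonPos : ContDiff ℝ (⊤ : ℕ∞) (solitonPos c κ) := by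
  have h1 : ContDiff ℝ (⊤ : ℕ∞) fun x => √(1 - eta c κ x) :=
    (contDiff_const.sub h.contDiff_eta).sqrt fun x => (sub_pos.2 (h.eta_lt_one hc x)).ne'
  unfold solitonPos
  exact (Complex.ofRealCLM.contDiff.comp h1).mul
    (((Complex.ofRealCLM.contDiff.comp (h.contDiff_theta hc)).mul contDiff_const).cexp)

/-- The logarithmic derivative of the soliton. -/
theorem hasDerivAt_solitonPos (x : ℝ) : HasDerivAt (solitonPos c κ) (solitonPos c κ x *
    ((-(deriv (eta c κ) x / 2 : ℝ) + Complex.I * (c / 2 * eta c κ x : ℝ)) /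
      (1 - eta c κ x : ℝ))) x := by
  have hpos := sub_pos.2 (h.eta_lt_one hc x)
  have hη := (h.hasDerivAt_eta x).differentiableAt.hasDerivAt
  have h1 := ((hη.const_sub 1).sqrt hpos.ne').ofReal_comp
  have h2 := (((h.hasDerivAt_theta hc x).ofReal_comp).mul_const Complex.I).cexp
  refine (h1.mul h2).congr_deriv ?_
  have hs := sq_sqrt hpos.le
  have hs0 := (sqrt_pos.2 hpos).ne'
  have e : -deriv (eta c κ) x / (2 * √(1 - eta c κ x))
      = √(1 - eta c κ x) * (-(deriv (eta c κ) x) / 2 / (1 - eta c κ x)) := by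
    rw [div_div, ← mul_div_assoc, div_eq_div_iff (by positivity) (by positivity)]
    linear_combination 2 * deriv (eta c κ) x * hs
  rw [solitonPos, e]
  push_cast
  ring

theorem deriv_solitonPos : deriv (solitonPos c κ) = fun x => solitonPos c κ x *
    ((-(deriv (eta c κ) x / 2 : ℝ) + Complex.I * (c / 2 * eta c κ x : ℝ)) /
      (1 - eta c κ x : ℝ)) :=
  funext fun x => (h.hasDerivAt_solitonPos hc x).deriv

theorem intensity_solitonPos_eq : intensity (solitonPos c κ) = eta c κ :=
  funext fun x => intensity_solitonPos (h.eta_lt_one hc x).le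

theorem twEquation_solitonPos : TWEquation c κ (solitonPos c κ) := by
  intro x
  have hpos := sub_pos.2 (h.eta_lt_one hc x)
  change Complex.I * (c : ℂ) * deriv (solitonPos c κ) x + deriv (deriv (solitonPos c κ)) x
    + solitonPos c κ x * ((intensity (solitonPos c κ) x : ℝ) : ℂ)
    + (κ : ℂ) * solitonPos c κ x * ((deriv (deriv (intensity (solitonPos c κ))) x : ℝ) : ℂ) = 0
  rw [h.intensity_solitonPos_eq hc, h.deriv_solitonPos hc]
  have hη := (h.hasDerivAt_eta x).differentiableAt.hasDerivAt
  have hη' := (h.hasDerivAt_deriv_eta x).differentiableAt.hasDerivAt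
  have hne : ((1 - eta c κ x : ℝ) : ℂ) ≠ 0 := by exact_mod_cast hpos.ne'
  have hd := ((h.hasDerivAt_solitonPos hc x).mul
    ((((hη'.div_const 2).ofReal_comp.neg).add
      ((hη.const_mul (c / 2)).ofReal_comp.const_mul Complex.I)).div
      (hη.const_sub 1).ofReal_comp hne)).deriv
  have E1 := h.deriv_eta_sq x
  have E2 := h.deriv_deriv_eta_eq x
  simp only [Pi.add_apply, Pi.neg_apply, Pi.div_apply] at hd
  erw [hd]
  beta_reduce
  generalize deriv (deriv (eta c κ)) x = n₂ at *
  generalize deriv (eta c κ) x = n₁ at *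
  generalize eta c κ x = n at *
  generalize solitonPos c κ x = u at *
  -- The equation divided by u and multiplied by (1 - η)². Its imaginary part cancels identically;
  -- this is its real part.
  have key : -(n₁ ^ 2 + c ^ 2 * n ^ 2) / 4
      + (1 - n) * (-c ^ 2 * n / 2 - n₂ / 2 + (1 - n) * (n + κ * n₂)) = 0 := by
    linear_combination (-1 / 4) * E1 - (1 - n) / 2 * E2
  have keyC : -((n₁ : ℂ) ^ 2 + c ^ 2 * n ^ 2) / 4
      + (1 - n) * (-c ^ 2 * n / 2 - n₂ / 2 + (1 - n) * (n + κ * n₂)) = 0 := by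
    exact_mod_cast congrArg (fun r : ℝ => (r : ℂ)) key
  push_cast at hne ⊢
  have hI := Complex.I_sq
  generalize (c : ℂ) = c at *
  field_simp
  linear_combination 4 * u * keyC + u * (2 * c ^ 2 * n * (1 - n) + c ^ 2 * n ^ 2) * hI

theorem energy_solitonPos (x : ℝ) : ‖deriv (solitonPos c κ) x‖ ^ 2
    = eta c κ x ^ 2 / 2 + κ * deriv (eta c κ) x ^ 2 / 2 := by
  have hpos := sub_pos.2 (h.eta_lt_one hc x)
  have hn : ‖solitonPos c κ x‖ ^ 2 = 1 - eta c κ x := by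
    have := intensity_solitonPos (h.eta_lt_one hc x).le
    unfold intensity at this
    linarith
  have E1 := h.deriv_eta_sq x
  rw [h.deriv_solitonPos hc]
  simp only [norm_mul, norm_div, mul_pow, div_pow, hn, Complex.norm_real, norm_eq_abs, sq_abs]
  rw [Complex.sq_norm, Complex.normSq_apply]
  simp only [Complex.add_re, Complex.add_im, Complex.neg_re, Complex.neg_im, Complex.ofReal_re,
    Complex.ofReal_im, Complex.mul_re, Complex.mul_im, Complex.I_re, Complex.I_im]
  have hne := hpos.ne'
  generalize deriv (eta c κ) x = n₁ at *
  generalize eta c κ x = n at *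
  apply mul_left_cancel₀ hne
  field_simp
  linear_combination E1

theorem isSmoothSol_solitonPos : IsSmoothSol c κ (solitonPos c κ) := by
  have h2 : ContDiff ℝ 2 (solitonPos c κ) :=
    by
    exact_mod_cast contDiff_infty.1 (h.contDiff_solitonPos hc) 2
  exact ⟨h2, h.mem_energySpace h2 (h.intensity_solitonPos_eq hc) (h.energy_solitonPos hc),
    h.twEquation_solitonPos hc⟩

end EtaData

/-! ### The black soliton -/

/-- The black soliton as a real valued function. -/
def blackProfile (κ x : ℝ) : ℝ := if 0 ≤ x then √(1 - eta 0 κ x) else -√(1 - eta 0 κ x)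

theorem blackSoliton_eq (κ : ℝ) : blackSoliton κ = fun x => ((blackProfile κ x : ℝ) : ℂ) := by
  funext x
  unfold blackSoliton blackProfile
  split_ifs <;> rfl

namespace EtaData

variable {κ p : ℝ} (h : EtaData 0 κ 1 1 p)
include h

theorem eta_black (x : ℝ) : eta 0 κ x = profile 1 p κ x := by rw [h.eta_eq, one_mul]

theorem eta_black_le (x : ℝ) : eta 0 κ x ≤ 1 := by
  rw [h.eta_black]
  exact (h.adm.profile_mem x).2

theorem blackProfile_sq (x : ℝ) : blackProfile κ x ^ 2 = 1 - eta 0 κ x := by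
  have := sub_nonneg.2 (h.eta_black_le x)
  unfold blackProfile
  split_ifs
  · exact sq_sqrt this
  · rw [neg_sq, sq_sqrt this]

theorem blackProfile_zero : blackProfile κ 0 = 0 := by
  have := h.blackProfile_sq 0
  rw [h.eta_zero] at this
  exact pow_eq_zero_iff two_ne_zero |>.1 (by rw [this]; norm_num)

theorem eta_black_neg (x : ℝ) : eta 0 κ (-x) = eta 0 κ x := by
  rw [h.eta_black, h.eta_black, profile_neg]

theorem blackProfile_neg (x : ℝ) : blackProfile κ (-x) = -blackProfile κ x := by
  rcases lt_trichotomy x 0 with hx | hx | hx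
  · rw [blackProfile, blackProfile, if_pos (by linarith), if_neg (by linarith), h.eta_black_neg,
      neg_neg]
  · rw [hx, neg_zero, h.blackProfile_zero, neg_zero]
  · rw [blackProfile, blackProfile, if_neg (by linarith), if_pos (by linarith), h.eta_black_neg]

theorem den_black_pos (x : ℝ) : 0 < p + 2 * κ * eta 0 κ x := by
  rw [h.eta_black]
  exact h.adm.den_profile_pos x

/-- The factor √(1 - η) in η' cancels against the one from differentiating the square root. What
remains is smooth and even, so it also serves at x = 0 and for x < 0. -/
theorem hasDerivAt_blackProfile_of_pos {x : ℝ} (hx : 0 < x) : HasDerivAt (blackProfile κ)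
    (eta 0 κ x / √(2 * (p + 2 * κ * eta 0 κ x))) x := by
  have hP := h.den_black_pos x
  have hlt : 0 < 1 - eta 0 κ x := by
    rw [h.eta_black]; exact sub_pos.2 (h.adm.profile_lt hx.ne')
  have e : blackProfile κ =ᶠ[𝓝 x] fun x => √(1 - eta 0 κ x) := by
    filter_upwards [eventually_gt_nhds hx] with z hz
    rw [blackProfile, if_pos hz.le]
  refine ((((h.hasDerivAt_eta x).const_sub 1).sqrt hlt.ne').congr_of_eventuallyEq e).congr_deriv ?_
  rw [profileDeriv, if_pos hx.le, ← h.eta_black, rate]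
  have e1 : (2 * 1 - 2 * eta 0 κ x) / (p + 2 * κ * eta 0 κ x)
      = (2 / √(2 * (p + 2 * κ * eta 0 κ x))) ^ 2 * (1 - eta 0 κ x) := by
    rw [div_pow, sq_sqrt (by positivity)]
    field_simp
  rw [e1, sqrt_mul (by positivity), sqrt_sq (by positivity)]
  have := (sqrt_pos.2 hlt).ne'
  field_simp

theorem hasDerivAt_blackProfile (x : ℝ) : HasDerivAt (blackProfile κ)
    (eta 0 κ x / √(2 * (p + 2 * κ * eta 0 κ x))) x := by
  have cη := h.contDiff_eta.continuous
  have key : ∀ y ≠ (0 : ℝ), HasDerivAt (blackProfile κ)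
      (eta 0 κ y / √(2 * (p + 2 * κ * eta 0 κ y))) y := by
    intro y hy
    rcases hy.lt_or_gt with hy | hy
    · have := ((h.hasDerivAt_blackProfile_of_pos (neg_pos.2 hy)).comp y (hasDerivAt_neg y)).neg
      rw [h.eta_black_neg] at this
      have e : -(blackProfile κ ∘ Neg.neg) = blackProfile κ := by
        funext z
        simp [h.blackProfile_neg]
      rw [e] at this
      simpa using this
    · exact h.hasDerivAt_blackProfile_of_pos hy
  by_cases hx : x = 0
  · subst hx
    refine hasDerivAt_of_hasDerivAt_of_ne key ?_ ?_
    · unfold ContinuousAt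
      rw [h.blackProfile_zero, tendsto_zero_iff_abs_tendsto_zero]
      have : Continuous fun x => √(1 - eta 0 κ x) := by fun_prop
      have := this.tendsto 0
      rw [h.eta_zero] at this
      simp only [ne_eq, OfNat.ofNat_ne_zero, not_false_eq_true, zero_pow, zero_div, sub_zero,
        sub_self, sqrt_zero] at this
      refine this.congr fun x => ?_
      rw [← h.blackProfile_sq, sqrt_sq_eq_abs]
      rfl
    · exact (Continuous.div (by fun_prop) (by fun_prop) fun x =>
        (sqrt_pos.2 (mul_pos two_pos (h.den_black_pos x))).ne').continuousAt
  · exact key x hx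

theorem contDiff_blackProfile : ContDiff ℝ (⊤ : ℕ∞) (blackProfile κ) := by
  rw [contDiff_infty_iff_deriv]
  refine ⟨fun x => (h.hasDerivAt_blackProfile x).differentiableAt, ?_⟩
  rw [funext fun x => (h.hasDerivAt_blackProfile x).deriv]
  have hη := h.contDiff_eta
  have hP := fun x => mul_pos two_pos (h.den_black_pos x)
  exact hη.div (ContDiff.sqrt (by fun_prop) fun x => (hP x).ne')
    fun x => (sqrt_pos.2 (hP x)).ne'

theorem contDiff_blackSoliton : ContDiff ℝ (⊤ : ℕ∞) (blackSoliton κ) := by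
  rw [blackSoliton_eq]
  exact Complex.ofRealCLM.contDiff.comp h.contDiff_blackProfile

theorem deriv_blackSoliton : deriv (blackSoliton κ) = fun x =>
    ((eta 0 κ x / √(2 * (p + 2 * κ * eta 0 κ x)) : ℝ) : ℂ) := by
  rw [blackSoliton_eq]
  exact funext fun x => (h.hasDerivAt_blackProfile x).ofReal_comp.deriv

theorem intensity_blackSoliton : intensity (blackSoliton κ) = eta 0 κ := by
  funext x
  rw [intensity, blackSoliton_eq, Complex.norm_real, norm_eq_abs, sq_abs, h.blackProfile_sq]
  ring

theorem deriv_eta_black (x : ℝ) : deriv (eta 0 κ) x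
    = -2 * blackProfile κ x * (eta 0 κ x / √(2 * (p + 2 * κ * eta 0 κ x))) := by
  have h1 := ((h.hasDerivAt_blackProfile x).pow 2).const_sub 1
  have e : (fun x => 1 - (blackProfile κ ^ 2) x) = eta 0 κ := by
    funext x
    rw [Pi.pow_apply, h.blackProfile_sq]
    ring
  rw [e] at h1
  rw [h1.deriv]
  simp

theorem twEquation_blackSoliton : TWEquation 0 κ (blackSoliton κ) := by
  intro x
  change Complex.I * ((0 : ℝ) : ℂ) * deriv (blackSoliton κ) x + deriv (deriv (blackSoliton κ)) x
    + blackSoliton κ x * ((intensity (blackSoliton κ) x : ℝ) : ℂ)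
    + (κ : ℂ) * blackSoliton κ x * ((deriv (deriv (intensity (blackSoliton κ))) x : ℝ) : ℂ) = 0
  have hP := h.den_black_pos x
  have hη := (h.hasDerivAt_eta x).differentiableAt.hasDerivAt
  have hS := ((((hη.const_mul (2 * κ)).const_add p).const_mul 2).sqrt
    (mul_pos two_pos hP).ne')
  have hs := (sqrt_pos.2 (mul_pos two_pos hP)).ne'
  have hs2 := sq_sqrt (mul_pos two_pos hP).le
  have hd := (hη.div hS hs).ofReal_comp.deriv
  have E1 := h.deriv_eta_sq x
  have E2 := h.deriv_deriv_eta_eq x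
  have E0 := h.deriv_eta_black x
  have hp := h.mul_p
  rw [h.intensity_blackSoliton, h.deriv_blackSoliton]
  simp only [Pi.div_apply] at hd
  rw [hd, blackSoliton_eq, Complex.ofReal_zero, mul_zero, zero_mul, zero_add]
  beta_reduce
  norm_cast
  set S := √(2 * (p + 2 * κ * eta 0 κ x))
  generalize deriv (deriv (eta 0 κ)) x = n₂ at *
  generalize deriv (eta 0 κ) x = n₁ at *
  generalize eta 0 κ x = n at *
  generalize blackProfile κ x = b at *
  -- Elimination of η'² between the first- and second-order laws for η.
  have key : (p + 2 * κ * n) ^ 2 * (n + κ * n₂) = n * (p + 2 * κ * n - κ * n) := by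
    rw [show p = 1 - 2 * κ by linarith]
    linear_combination κ * (1 - 2 * κ + 2 * κ * n) * E2 - κ ^ 2 * E1
  have hB : (n₁ * S - n * (2 * (2 * κ * n₁) / (2 * S))) / S ^ 2
      = -2 * b * n * (S ^ 2 - 2 * κ * n) / (S ^ 2) ^ 2 := by
    rw [E0]
    field_simp
    ring
  rw [hB, hs2]
  generalize p + 2 * κ * n = P at *
  have e : -2 * b * n * (2 * P - 2 * κ * n) / (2 * P) ^ 2 = -(b * (n + κ * n₂)) := by
    rw [div_eq_iff (by positivity)]
    linear_combination 4 * b * key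
  rw [e]
  ring

theorem energy_blackSoliton (x : ℝ) : ‖deriv (blackSoliton κ) x‖ ^ 2
    = eta 0 κ x ^ 2 / 2 + κ * deriv (eta 0 κ) x ^ 2 / 2 := by
  have hP := h.den_black_pos x
  have E1 := h.deriv_eta_sq x
  have hp := h.mul_p
  rw [h.deriv_blackSoliton, Complex.norm_real, norm_eq_abs, sq_abs, div_pow,
    sq_sqrt (mul_pos two_pos hP).le]
  rw [div_eq_iff (mul_pos two_pos hP).ne']
  generalize deriv (eta 0 κ) x = n₁ at *
  generalize eta 0 κ x = n at *
  rw [one_mul] at hp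
  subst hp
  linear_combination -κ * E1

theorem isSmoothSol_blackSoliton : IsSmoothSol 0 κ (blackSoliton κ) := by
  have h2 : ContDiff ℝ 2 (blackSoliton κ) :=
    by
    exact_mod_cast contDiff_infty.1 h.contDiff_blackSoliton 2
  exact ⟨h2, h.mem_energySpace h2 h.intensity_blackSoliton h.energy_blackSoliton,
    h.twEquation_blackSoliton⟩

end EtaData

/-! ### Monotonicity and the global extremum. -/

theorem Admissible.profileDeriv_neg {m p κ : ℝ} (h : Admissible m p κ) {x : ℝ} (hx : 0 < x) :
    profileDeriv m p κ x < 0 := by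
  have hy := h.profile_mem x
  rw [profileDeriv, if_pos hx.le, neg_lt_zero]
  exact mul_pos hy.1 (sqrt_pos.2 (h.rate_pos ⟨hy.1.le, h.profile_lt hx.ne'⟩))

theorem EtaData.isExtrOn_eta {c κ s m p : ℝ} (h : EtaData c κ s m p) :
    IsExtrOn (eta c κ) univ 0 := by
  have hy := fun x => (h.adm.profile_mem x).2
  rcases h.sign with rfl | rfl
  · refine Or.inr fun x _ => ?_
    simpa [h.eta_eq, h.adm.profile_zero] using hy x
  · refine Or.inl fun x _ => ?_
    simpa [h.eta_eq, h.adm.profile_zero] using hy x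

theorem etaData_black {κ : ℝ} (h : ((0 : ℝ), κ) ∈ D) : EtaData 0 κ 1 1 (1 - 2 * κ) := by
  rcases h with h | h
  · simpa using etaData_of_mem_D₁_union_D₂ h
  · exact absurd h.1 (not_lt.2 (sqrt_nonneg 2))

end

end QGP

theorem theorem1p1 (c κ : ℝ) (hc : 0 ≤ c) :
    -- outside of `D` there are only trivial solutions
    ((c, κ) ∉ QGP.D → ∀ u : ℝ → ℂ, QGP.IsSmoothSol c κ u →
      ∃ φ : ℝ, ∀ x : ℝ, u x = Complex.exp ((φ : ℂ) * Complex.I)) ∧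
    ((c, κ) ∈ QGP.D →
      -- the functions whose inverses define `η` are invertible
      ((c, κ) ∈ QGP.D₁ →
        Set.BijOn (QGP.funF c κ) (QGP.intervalI c) (Set.Ici 0)) ∧
      ((c, κ) ∈ QGP.D₂ →
        Set.BijOn (QGP.funG c κ) (QGP.intervalI c) (Set.Ici 0)) ∧
      ((c, κ) ∈ QGP.D₃ →
        Set.BijOn (QGP.funH c κ) (QGP.intervalJ c) (Set.Ici 0)) ∧
      -- existence and uniqueness of the nontrivial solution
      (0 < c → (∀ x : ℝ, QGP.eta c κ x < 1) ∧
        QGP.IsUniqueNontrivialSol c κ (QGP.solitonPos c κ)) ∧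
      (c = 0 → (∀ x : ℝ, (QGP.blackSoliton κ x).im = 0) ∧
        (∀ x : ℝ, QGP.blackSoliton κ (-x) = -QGP.blackSoliton κ x) ∧
        QGP.IsUniqueNontrivialSol c κ (QGP.blackSoliton κ)) ∧
      -- smoothness
      ContDiff ℝ (⊤ : ℕ∞) (QGP.soliton c κ) ∧
      ContDiff ℝ (⊤ : ℕ∞) (QGP.eta c κ) ∧
      -- symmetry, extremum and monotonicity of the intensity profile
      (∀ x : ℝ, QGP.eta c κ (-x) = QGP.eta c κ x) ∧
      IsExtrOn (QGP.eta c κ) Set.univ 0 ∧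
      QGP.eta c κ 0 = 1 - c ^ 2 / 2 ∧
      ((c, κ) ∈ QGP.D₁ ∪ QGP.D₂ → ∀ x : ℝ, 0 < x →
        0 < QGP.eta c κ x ∧ deriv (QGP.eta c κ) x < 0) ∧
      ((c, κ) ∈ QGP.D₃ → ∀ x : ℝ, 0 < x →
        QGP.eta c κ x < 0 ∧ 0 < deriv (QGP.eta c κ) x) ∧
      -- exponential decay of all derivatives
      ∃ C : ℝ, 0 < C ∧ ∀ k : ℕ, ∃ A : ℝ, 0 < A ∧ ∀ x : ℝ,
        ‖iteratedDeriv k (deriv (QGP.soliton c κ)) x‖ + |iteratedDeriv k (QGP.eta c κ) x|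
          ≤ A * Real.exp (-C * |x|)) := by
  refine ⟨fun hD u hu => hu.isTrivial_of_notMem hc hD, fun hD => ?_⟩
  obtain ⟨s, m, p, h⟩ := QGP.exists_etaData hD
  refine ⟨QGP.bijOn_funF, QGP.bijOn_funG, QGP.bijOn_funH, fun hpos => ⟨h.eta_lt_one hpos,
    h.isUniqueNontrivialSol (h.isSmoothSol_solitonPos hpos) (h.intensity_solitonPos_eq hpos)⟩,
    ?_, ?_, h.contDiff_eta, fun x => by rw [h.eta_eq, h.eta_eq, QGP.profile_neg], h.isExtrOn_eta,
    h.eta_zero, fun h12 x hx => ?_, fun h3 x hx => ?_, ?_⟩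
  · rintro rfl
    have h0 := QGP.etaData_black hD
    refine ⟨fun x => ?_, fun x => ?_, h0.isUniqueNontrivialSol h0.isSmoothSol_blackSoliton
      h0.intensity_blackSoliton⟩
    · rw [QGP.blackSoliton_eq]
      exact Complex.ofReal_im _
    · rw [QGP.blackSoliton_eq]
      simp only [h0.blackProfile_neg, Complex.ofReal_neg]
  · unfold QGP.soliton
    split_ifs with h0
    · subst h0
      exact (QGP.etaData_black hD).contDiff_blackSoliton
    · exact h.contDiff_solitonPos (lt_of_le_of_ne hc (Ne.symm h0))
  · have h' := QGP.etaData_of_mem_D₁_union_D₂ h12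
    rw [h'.deriv_eta, h'.eta_eq, one_mul]
    exact ⟨(h'.adm.profile_mem x).1, by simpa using h'.adm.profileDeriv_neg hx⟩
  · have h' := QGP.etaData_of_mem_D₃ h3
    rw [h'.deriv_eta, h'.eta_eq]
    exact ⟨by linarith [(h'.adm.profile_mem x).1], by simpa using h'.adm.profileDeriv_neg hx⟩
  · unfold QGP.soliton
    split_ifs with h0
    · subst h0
      have h0 := QGP.etaData_black hD
      have hs := h0.isSmoothSol_blackSoliton
      exact h0.exists_exp_bound hs.1 h0.intensity_blackSoliton h0.energy_blackSoliton hs.2.2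
    · have hpos := lt_of_le_of_ne hc (Ne.symm h0)
      have hs := h.isSmoothSol_solitonPos hpos
      exact h.exists_exp_bound hs.1 (h.intensity_solitonPos_eq hpos) (h.energy_solitonPos hpos)
        hs.2.2
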